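/- **Setting.** Let $A$ be a countable alphabet with a fixed enumeration, $A^{-\mathbb N}$ the set of infinite pasts $\underline z=\ldots z_{-2}z_{-1}$, and $P(a|\underline z)$ a transition probability kernel, i.e. $P(\cdot|\underline z)$ is a probability distribution on $A$ for every $\underline z\in A^{-\mathbb N}$. In conditionings, strings are written from the most recent one backwards: $P(a|b\,w\,c\,\underline z)$ refers to the past that ends with $b$, preceded by $w$, then by $c$, then by $\underline z$. Put $\alpha(a)=\inf_{\underline z}P(a|\underline z)$, $\mathcal E=\{a\in A:\alpha(a)>0\}$, and $\alpha_{-1}=\sum_{a}\alpha(a)$. Assume $\mathcal E\ne\emptyset$ and let $w$ be a finite string of symbols of $\mathcal E$. For a finite string $v$ let $m^w(v)$ be the distance from the end of $v$ to the last occurrence of $w$ in $v$ ($+\infty$ if there is none). For $k\ge 0$ let $$\alpha^w_k=\inf_{i\ge0}\ \inf_{b}\ \inf_{c\in A^k}\ \sum_{a\in A}\inf_{\underline z}P(a|b\,w\,c\,\underline z),$$ where $b$ ranges over the strings of length $i$ such that in the string formed by $w$ followed by $b$ the last occurrence of $w$ is at distance exactly $i$; put $\alpha^w_{-1}=\alpha_{-1}$.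 **Update function.** Glue in $[0,1[$, starting from $0$, first the intervals $I(a)$ of length $\alpha(a)$, in the order of the enumeration of $A$. For a finite string $v$ with $m^w(v)<\infty$ and $0\le k\le|v|-m^w(v)-|w|$, let $\alpha^w(a,v,k)$ be the infimum of $P(a|\cdot)$ over the pasts that agree with $v$ on their last $m^w(v)+|w|+k$ symbols, and $\alpha^w(a,v,-1)=\alpha(a)$; glue successively for $k=0,1,\ldots$, and for each $k$ in the order of the enumeration of $A$, intervals $I^w(a,v,k)$ of length $\alpha^w(a,v,k)-\alpha^w(a,v,k-1)$. For $u\in[0,1[$ and a finite string $v$, let $F(u,v)=a$ if $u<\alpha_{-1}$ and $u\in I(a)$; let $F(u,v)=a$ if $\alpha^w_{l-1}\le u<\alpha^w_l$ for some $l\ge0$, $m^w(v)+|w|+l\le|v|$ and $u\in\bigcup_{k=0}^{l}I^w(a,v,k)$; and let $F(u,v)=\star$ otherwise. **Regeneration time.** Let $(U_i)_{i\in\mathbb Z}$ be i.i.d. uniform on $[0,1[$. For $k\in\mathbb Z$ and $k\le n\le+\infty$, the window $[k,n]$ is constructible if there are symbols $a_i$ with $F(U_i,a_k^{i-1})=a_i$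 for all $k\le i\le n$, $i<\infty$. For $-\infty<m\le n\le+\infty$ let $\theta[m,n]=\max\{k\le m:[k,n]\text{ is constructible}\}$ ($-\infty$ if there is no such $k$), and $\theta[n]=\theta[n,n]$. **Algorithm.** For $-\infty<m\le n<+\infty$: let $B=\{m,\ldots,n\}$, $i\leftarrow m$; while $B\neq\emptyset$ and $F(U_i,X_m^{i-1})\ne\star$, set $X_i\leftarrow F(U_i,X_m^{i-1})$, remove $i$ from $B$, and let $i\leftarrow i+1$. Then let $i\leftarrow m$. While $B\ne\emptyset$: let $i\leftarrow i-1$ and add $i$ to $B$, and repeat these two operations as long as $U_i\in[\alpha_{-1},1[$; set $X_i\leftarrow F(U_i,\emptyset)$, remove $i$ from $B$, let $t\leftarrow\min B$, and, while $B\ne\emptyset$ and $F(U_t,X_i^{t-1})\neq\star$, set $X_t\leftarrow F(U_t,X_i^{t-1})$, remove $t$ from $B$, and let $t\leftarrow\min B$. When $B=\emptyset$, stop and return the time $i$ (with $X_i,\ldots,X_n$). **Theorem 2.** The conditions $\sum_{k\ge0}(1-\alpha^w_k)<\infty$ and $\prod_{k\ge0}\alpha^w_k>0$ are equivalent. If they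 hold (in particular $\alpha^w_k\to1$), then for all $-\infty<m\le n<+\infty$ the algorithm almost surely stops after a finite number of steps, and it returns $\theta[m,n]$, which is finite; for the infinite windows, $\theta[m,+\infty]>-\infty$ almost surely for every $m\in\mathbb Z$. Moreover, for every $n\in\mathbb Z$, $$\sum_{l\ge0}\mathbb P(\theta[n]<n-l)<\infty;\qquad\text{in particular}\qquad \sum_{l\ge0}\mathbb P(\theta[0]<-l)<\infty .$$ -/

import Mathlib

open MeasureTheory ProbabilityTheory
open scoped ENNReal

/-!
Conventions.  The alphabet `A` is countable and enumerated by `Encodable.encode`.  A string of past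
symbols is listed from the most recent symbol backwards: the infinite past `… a₋₂ a₋₁` is the stream
`a₋₁, a₋₂, …`, and the finite past `a₋ₘ … a₋₁` is the list `[a₋₁, …, a₋ₘ]`.  The reference string
`w` is listed in the same way.  A kernel is a map `P : Stream' A → PMF A`, where `P z a` is the
probability of the next symbol `a` given the past `z`, and `v ++ₛ z` is the infinite past which
ends with the finite string `v`.
-/

namespace CFTP

noncomputable section

variable {A : Type*}

/-! ### Occurrences of the reference string -/

/-- `m^w(v)`: the distance to the last occurrence of `w` in the finite past `v`
(`⊤` if there is none). -/
def lastOcc (w v : List A) : ℕ∞ :=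
  ⨅ (k : ℕ) (_ : w <+: v.drop k), (k : ℕ∞)

/-- The strings `b` of length `i` such that, in a past which ends with `w` followed by `b`,
the last occurrence of `w` is at distance exactly `i`. -/
def returnFree (w : List A) (i : ℕ) : Set (List A) :=
  {b | b.length = i ∧ lastOcc w (b ++ w) = i}

/-! ### Infima of the kernel -/

/-- `α(a) = inf_z P(a | z)`. -/
def spontMass (P : Stream' A → PMF A) (a : A) : ℝ≥0∞ :=
  ⨅ z : Stream' A, P z a

/-- The set `ℰ` of symbols `a` with `inf_z P(a | z) > 0`. -/
def minorized (P : Stream' A → PMF A) : Set A :=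
  {a | 0 < spontMass P a}

/-- `α₋₁ = ∑ₐ α(a)`. -/
def alphaNegOne (P : Stream' A → PMF A) : ℝ≥0∞ :=
  ∑' a, spontMass P a

/-- `α^w_k`: the infimum, over all `i`, all `b` of length `i` with no later occurrence of `w`, and
all `c` of length `k`, of `∑ₐ inf_z P(a | b w c z)` (most recent symbols first). -/
def alpha (P : Stream' A → PMF A) (w : List A) (k : ℕ) : ℝ≥0∞ :=
  ⨅ (i : ℕ) (b ∈ returnFree w i) (c : List A) (_ : c.length = k),
    ∑' a, ⨅ z : Stream' A, P ((b ++ w ++ c) ++ₛ z) a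

/-- `α^w_{k-1}` for `k ≥ 0`. -/
def alphaPred (P : Stream' A → PMF A) (w : List A) : ℕ → ℝ≥0∞
  | 0 => alphaNegOne P
  | k + 1 => alpha P w k

/-- `α^w(a, v, k)`: the infimum of `P(a | ·)` over the pasts which agree with `v` up to the `k`
symbols that precede the last occurrence of `w` in `v`.  It is used only when
`m^w(v) + |w| + k ≤ |v|`. -/
def ctxMass (P : Stream' A → PMF A) (w v : List A) (k : ℕ) (a : A) : ℝ≥0∞ :=
  ⨅ z : Stream' A, P (v.take ((lastOcc w v).toNat + w.length + k) ++ₛ z) a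

/-- `α^w(a, v, k-1)` for `k ≥ 0`, with `α(a)` for `k = 0`. -/
def ctxMassPred (P : Stream' A → PMF A) (w v : List A) : ℕ → A → ℝ≥0∞
  | 0 => spontMass P
  | k + 1 => ctxMass P w v k

/-! ### The intervals -/

/-- Intervals of lengths `len a`, glued one after the other in the order of the enumeration of the
alphabet, the first of them starting at `s`: the interval of the symbol `a`. -/
def glued [Encodable A] (s : ℝ≥0∞) (len : A → ℝ≥0∞) (a : A) : Set ℝ≥0∞ :=
  Set.Ico (s + ∑' b : {b : A // Encodable.encode b < Encodable.encode a}, len b)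
    ((s + ∑' b : {b : A // Encodable.encode b < Encodable.encode a}, len b) + len a)

/-- `I(a)`, of length `α(a)`. -/
def spontInterval [Encodable A] (P : Stream' A → PMF A) (a : A) : Set ℝ≥0∞ :=
  glued 0 (spontMass P) a

/-- `I^w(a, v, k)`, of length `α^w(a, v, k) - α^w(a, v, k-1)`; the intervals of index `k` start
where those of index `k-1` end. -/
def ctxInterval [Encodable A] (P : Stream' A → PMF A) (w v : List A) (k : ℕ) (a : A) :
    Set ℝ≥0∞ :=
  glued (∑' b, ctxMassPred P w v k b)
    (fun b => ctxMass P w v k b - ctxMassPred P w v k b) a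

/-! ### The update function -/

/-- Some suffix of the finite past `v` is a context of the tree `τ^w_l`, whose finite contexts are
the strings `c w b` with `b` free of later occurrences of `w` and `|c| = l`. -/
def HasContext (w : List A) (l : ℕ) (v : List A) : Prop :=
  lastOcc w v + w.length + l ≤ v.length

/-- The symbol `a` is selected by `u` and the finite past `v`: either `u < α₋₁` (level `-1`) and
`u ∈ I(a)`, or `α^w_{l-1} ≤ u < α^w_l` for some level `l ≥ 0`, the past `v` contains a context of
`τ^w_l`, and `u ∈ ⋃_{k ≤ l} I^w(a, v, k)`. -/
def Selects [Encodable A] (P : Stream' A → PMF A) (w : List A) (u : ℝ≥0∞) (v : List A) (a : A) :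
    Prop :=
  (u < alphaNegOne P ∧ u ∈ spontInterval P a) ∨
    ∃ l : ℕ, alphaPred P w l ≤ u ∧ u < alpha P w l ∧ HasContext w l v ∧
      ∃ k ≤ l, u ∈ ctxInterval P w v k a

open Classical in
/-- The update function `F(u, v)`; the value `none` is the symbol `⋆`. -/
def update [Encodable A] (P : Stream' A → PMF A) (w : List A) (u : ℝ) (v : List A) : Option A :=
  if h : ∃ a, Selects P w (ENNReal.ofReal u) v a then some h.choose else none

/-! ### The regeneration time -/

/-- The string `a_m … a_{i-1}`, most recent symbol first. -/
def window (a : ℤ → A) (m i : ℤ) : List A :=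
  (List.range (i - m).toNat).map fun j => a (i - 1 - j)

/-- `𝓛(u_m^n) = 1`: the sites of `[m, n]` can all be constructed from `u_m, …, u_n`
(`n = ⊤` is the window `[m, +∞)`). -/
def Constructible [Encodable A] (P : Stream' A → PMF A) (w : List A) (u : ℤ → ℝ)
    (m : ℤ) (n : WithTop ℤ) : Prop :=
  ∃ a : ℤ → A, ∀ i : ℤ, m ≤ i → (i : WithTop ℤ) ≤ n →
    update P w (u i) (window a m i) = some (a i)

open Classical in
/-- `θ[m, n] = max {k ≤ m : 𝓛(u_k^n) = 1}`, which is `⊥` (that is, `-∞`) if there is no such `k`.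
A set of integers which is nonempty and bounded above contains its supremum. -/
def regenTime [Encodable A] (P : Stream' A → PMF A) (w : List A) (u : ℤ → ℝ)
    (m : ℤ) (n : WithTop ℤ) : WithBot ℤ :=
  if {k : ℤ | k ≤ m ∧ Constructible P w u k n}.Nonempty then
    ((sSup {k : ℤ | k ≤ m ∧ Constructible P w u k n} : ℤ) : WithBot ℤ)
  else ⊥

/-! ### The coupling-from-the-past algorithm -/

/-- The instructions of the algorithm. -/
inductive Instr
  | fwdTest | fwdAssign | fwdRemove | fwdNext | restart
  | outerTest | backMove | backAdd
  | skipTest | skipMove | skipAdd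
  | seedAssign | seedRemove | seedMin
  | extTest | extAssign | extRemove | extMin
  | setTime | halt
  deriving DecidableEq

/-- A configuration: the next instruction, the variables `i`, `t`, `θ`, the set `B` of the sites
which remain to be constructed, and the sites constructed so far (`none` is `⋆`). -/
structure Config (A : Type*) where
  pc : Instr
  i : ℤ
  t : ℤ
  theta : ℤ
  B : Finset ℤ
  X : ℤ → Option A

/-- The string `X_m … X_{i-1}` in the memory of the algorithm, most recent symbol first.  Whenever
the algorithm reads it, all these sites have been constructed. -/
def memWindow (X : ℤ → Option A) (m i : ℤ) : List A :=
  (List.range (i - m).toNat).filterMap fun j => X (i - 1 - j)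

/-- The initial configuration for the window `[m, n]`. -/
def Config.init (A : Type*) (m n : ℤ) : Config A where
  pc := .fwdTest
  i := m
  t := m
  theta := m
  B := Finset.Icc m n
  X := fun _ => none

open Classical in
/-- One step of the algorithm, run on the uniform variables `u` (to sample `U_i` is to read `u i`).
The assignment of the minimum of `B` to `t` is void if `B` is empty.

* Forward phase: while `B ≠ ∅` and `F(u_i, X_m^{i-1}) ≠ ⋆`, construct the site `i`, remove it from
  `B`, and pass to `i + 1`.  Then `i ← m`.
* While `B ≠ ∅`: move `i` one step back and add it to `B`, and again as long as `u_i ∈ [α₋₁, 1)`;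
  set `X_i ← F(u_i, ∅)`, remove `i` from `B`, let `t ← min B`, and, while `B ≠ ∅` and
  `F(u_t, X_i^{t-1}) ≠ ⋆`, construct the site `t`, remove it from `B`, and let `t ← min B`.
* Let `θ ← i` and halt. -/
def step [Encodable A] (P : Stream' A → PMF A) (w : List A) (u : ℤ → ℝ) (m : ℤ)
    (s : Config A) : Config A :=
  match s.pc with
  | .fwdTest =>
      if s.B.Nonempty ∧ (update P w (u s.i) (memWindow s.X m s.i)).isSome then
        { s with pc := .fwdAssign }
      else { s with pc := .restart }
  | .fwdAssign =>
      { s with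
        pc := .fwdRemove
        X := Function.update s.X s.i (update P w (u s.i) (memWindow s.X m s.i)) }
  | .fwdRemove => { s with pc := .fwdNext, B := s.B.erase s.i }
  | .fwdNext => { s with pc := .fwdTest, i := s.i + 1 }
  | .restart => { s with pc := .outerTest, i := m }
  | .outerTest =>
      if s.B.Nonempty then { s with pc := .backMove } else { s with pc := .setTime }
  | .backMove => { s with pc := .backAdd, i := s.i - 1 }
  | .backAdd => { s with pc := .skipTest, B := insert s.i s.B }
  | .skipTest =>
      if alphaNegOne P ≤ ENNReal.ofReal (u s.i) then { s with pc := .skipMove }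
      else { s with pc := .seedAssign }
  | .skipMove => { s with pc := .skipAdd, i := s.i - 1 }
  | .skipAdd => { s with pc := .skipTest, B := insert s.i s.B }
  | .seedAssign =>
      { s with pc := .seedRemove, X := Function.update s.X s.i (update P w (u s.i) []) }
  | .seedRemove => { s with pc := .seedMin, B := s.B.erase s.i }
  | .seedMin => { s with pc := .extTest, t := s.B.min.untopD s.t }
  | .extTest =>
      if s.B.Nonempty ∧ (update P w (u s.t) (memWindow s.X s.i s.t)).isSome then
        { s with pc := .extAssign }
      else { s with pc := .outerTest }
  | .extAssign =>
      { s with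
        pc := .extRemove
        X := Function.update s.X s.t (update P w (u s.t) (memWindow s.X s.i s.t)) }
  | .extRemove => { s with pc := .extMin, B := s.B.erase s.t }
  | .extMin => { s with pc := .extTest, t := s.B.min.untopD s.t }
  | .setTime => { s with pc := .halt, theta := s.i }
  | .halt => s

/-- Run on the window `[m, n]` with the uniform variables `u`, the algorithm stops after a finite
number of steps, and the time which it returns is `r`. -/
def StopsWith [Encodable A] (P : Stream' A → PMF A) (w : List A) (u : ℤ → ℝ) (m n : ℤ)
    (r : ℤ) : Prop :=
  ∃ N : ℕ, ((step P w u m)^[N] (Config.init A m n)).pc = .halt ∧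
    ((step P w u m)^[N] (Config.init A m n)).theta = r

end

end CFTP

/-! The proof separates a deterministic identity from a probability estimate.

Deterministic part. `update` reads the past only inside a context, so a symbol once selected stays
selected when older symbols are added (`update_append`). Hence the values already stored remain
correct as the algorithm moves back, and an extension loop that leaves `B` nonempty exhibits a
blocked site, which proves that `[i, n]` is not constructible. Skipping the sites with `u i ≥ α₋₁`
loses nothing, because a constructible window starts with a spontaneous symbol. The walk back
therefore ends exactly at the largest valid start (`stopsWith_of_isGreatest`).

Probabilistic part. Constructibility from `s` follows from a condition on the uniforms alone
(`SiteOk`): each site is spontaneous, or its uniform lies below `α^w_k`, where `k` is the number of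
sites between `s` and some earlier spontaneous copy of `w`. With probability `c > 0` this holds on a
whole half-line (`measure_allOk_pos`): force copies of `w` in finitely many initial blocks;
independently of them, all later failures have total probability below one. Indeed a long gap
without `w` is geometrically unlikely, and exceeding `α^w` at a level of order half the elapsed time
is summable by hypothesis.

A renewal argument concludes. The events "no valid start in `[0, l]`, and the half-line from `l + 1`
is good" are disjoint in `l` and have probability `P(no start in [0, l]) * c`, so the sum over `l`
of these probabilities is at most `1 / c`. Stationarity turns this into the tail bound for `θ[n]`,
and the vanishing remainders of the series give a good half-line starting before any `m`
(`ae_exists_allOk`). -/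

namespace CFTP

/-! ### Consecutive intervals indexed by the alphabet -/

section Gluing

variable {A : Type*} [Encodable A]

/-- The total length of the symbols whose code is below `N`. -/
noncomputable def cumLength (len : A → ℝ≥0∞) (N : ℕ) : ℝ≥0∞ :=
  ∑' b : {b : A // Encodable.encode b < N}, len b

lemma cumLength_eq (len : A → ℝ≥0∞) (N : ℕ) :
    cumLength len N = ∑' b, if Encodable.encode b < N then len b else 0 := by
  exact (tsum_subtype {b : A | Encodable.encode b < N} len).trans
    (tsum_congr fun b => by simp [Set.indicator_apply])

lemma cumLength_zero (len : A → ℝ≥0∞) : cumLength len 0 = 0 := by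
  simp [cumLength_eq]

lemma cumLength_mono (len : A → ℝ≥0∞) : Monotone (cumLength len) := by
  intro M N h
  rw [cumLength_eq, cumLength_eq]
  refine ENNReal.tsum_le_tsum fun b => ?_
  split_ifs with h1 h2
  · exact le_rfl
  · omega
  · exact zero_le
  · exact le_rfl

lemma cumLength_le_tsum (len : A → ℝ≥0∞) (N : ℕ) : cumLength len N ≤ ∑' b, len b := by
  rw [cumLength_eq]
  refine ENNReal.tsum_le_tsum fun b => ?_
  split_ifs
  · exact le_rfl
  · exact zero_le

lemma cumLength_encode_succ (len : A → ℝ≥0∞) (a : A) :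
    cumLength len (Encodable.encode a + 1) = cumLength len (Encodable.encode a) + len a := by
  classical
  rw [cumLength_eq, cumLength_eq, ← tsum_ite_eq a len, ← ENNReal.tsum_add]
  refine tsum_congr fun b => ?_
  by_cases hb : b = a
  · subst hb; simp
  · have : Encodable.encode b ≠ Encodable.encode a := fun h => hb (Encodable.encode_injective h)
    have h2 : Encodable.encode b < Encodable.encode a + 1 ↔
      Encodable.encode b < Encodable.encode a := by omega
    simp [hb, h2]

lemma cumLength_succ_of_forall_ne (len : A → ℝ≥0∞) (N : ℕ)
    (h : ∀ a : A, Encodable.encode a ≠ N) : cumLength len (N + 1) = cumLength len N := by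
  rw [cumLength_eq, cumLength_eq]
  refine tsum_congr fun b => ?_
  have := h b
  have h2 : Encodable.encode b < N + 1 ↔ Encodable.encode b < N := by omega
  simp [h2]

lemma exists_lt_cumLength (len : A → ℝ≥0∞) {x : ℝ≥0∞} (hx : x < ∑' b, len b) :
    ∃ N, x < cumLength len N := by
  rw [ENNReal.tsum_eq_iSup_sum, lt_iSup_iff] at hx
  obtain ⟨s, hs⟩ := hx
  refine ⟨s.sup Encodable.encode + 1, hs.trans_le ?_⟩
  rw [cumLength_eq]
  refine le_trans (le_of_eq (Finset.sum_congr rfl fun b hb => ?_)) (ENNReal.sum_le_tsum s)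
  have : Encodable.encode b ≤ s.sup Encodable.encode := Finset.le_sup (f := Encodable.encode) hb
  rw [if_pos (by omega)]

lemma mem_glued {s : ℝ≥0∞} {len : A → ℝ≥0∞} {a : A} {u : ℝ≥0∞} :
    u ∈ glued s len a ↔ s + cumLength len (Encodable.encode a) ≤ u ∧
      u < s + cumLength len (Encodable.encode a + 1) := by
  rw [cumLength_encode_succ, ← add_assoc]; rfl

/-- The glued intervals cover `[s, s + ∑ len)`. -/
lemma exists_mem_glued {s : ℝ≥0∞} {len : A → ℝ≥0∞} {u : ℝ≥0∞} (h1 : s ≤ u)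
    (h2 : u < s + ∑' b, len b) : ∃ a, u ∈ glued s len a := by
  classical
  have hex : ∃ N, u < s + cumLength len N := by
    obtain ⟨N, hN⟩ := exists_lt_cumLength len (x := u - s)
      (by
        refine ENNReal.sub_lt_of_lt_add h1 ?_
        rwa [add_comm] at h2)
    refine ⟨N, ?_⟩
    have hs : s ≠ ∞ := ne_top_of_le_ne_top h2.ne_top h1
    calc u = s + (u - s) := (add_tsub_cancel_of_le h1).symm
      _ < s + cumLength len N := ENNReal.add_lt_add_left hs hN
  have hspec := Nat.find_spec hex
  rcases hN : Nat.find hex with _ | N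
  · rw [hN, cumLength_zero, add_zero] at hspec
    exact absurd hspec (not_lt.2 h1)
  · have hlow := Nat.find_min hex (by omega : N < Nat.find hex)
    rw [hN] at hspec
    -- `N + 1` is the least bound whose cumulative length passes `u`, so `N` must be the code of a
    -- symbol: an unused code adds no length.
    by_cases hcode : ∃ a : A, Encodable.encode a = N
    · obtain ⟨a, rfl⟩ := hcode
      exact ⟨a, mem_glued.2 ⟨not_lt.1 hlow, hspec⟩⟩
    · push Not at hcode
      rw [cumLength_succ_of_forall_ne len _ hcode] at hspec
      exact absurd hspec hlow

lemma glued_unique {s : ℝ≥0∞} {len : A → ℝ≥0∞} {u : ℝ≥0∞} {a b : A}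
    (ha : u ∈ glued s len a) (hb : u ∈ glued s len b) : a = b := by
  rw [mem_glued] at ha hb
  have key : ∀ {c d : A}, s + cumLength len (Encodable.encode c) ≤ u →
      u < s + cumLength len (Encodable.encode d + 1) →
      Encodable.encode c ≤ Encodable.encode d := by
    intro c d hc hd
    by_contra! hlt
    exact absurd (hc.trans_lt hd) (not_lt.2 (add_le_add_right (cumLength_mono len hlt) s))
  exact Encodable.encode_injective (le_antisymm (key ha.1 hb.2) (key hb.1 ha.2))

lemma glued_subset {s : ℝ≥0∞} {len : A → ℝ≥0∞} {u : ℝ≥0∞} {a : A}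
    (ha : u ∈ glued s len a) : s ≤ u ∧ u < s + ∑' b, len b := by
  rw [mem_glued] at ha
  exact ⟨le_self_add.trans ha.1, ha.2.trans_le (add_le_add_right (cumLength_le_tsum len _) s)⟩

end Gluing

/-! ### Bounds and monotonicity of the infima of the kernel -/

section Infima

variable {A : Type*} (P : Stream' A → PMF A)

/-- Infima over longer pasts are larger. -/
lemma iInf_append_le (v v' : List A) (a : A) :
    ⨅ z : Stream' A, P (v ++ₛ z) a ≤ ⨅ z : Stream' A, P ((v ++ v') ++ₛ z) a := by
  refine le_iInf fun z => ?_
  rw [Stream'.append_append_stream]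
  exact iInf_le _ _

lemma spontMass_le (v : List A) (a : A) : spontMass P a ≤ ⨅ z : Stream' A, P (v ++ₛ z) a :=
  le_iInf fun _ => iInf_le _ _

lemma tsum_iInf_le_one [Nonempty A] (v : List A) :
    ∑' a, ⨅ z : Stream' A, P (v ++ₛ z) a ≤ 1 := by
  have z : Stream' A := fun _ => Classical.arbitrary A
  rw [← (P (v ++ₛ z)).tsum_coe]
  exact ENNReal.tsum_le_tsum fun a => iInf_le _ z

lemma alphaNegOne_le_alpha (w : List A) (k : ℕ) : alphaNegOne P ≤ alpha P w k := by
  refine le_iInf fun i => le_iInf fun b => le_iInf fun _ => le_iInf fun c => le_iInf fun _ => ?_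
  exact ENNReal.tsum_le_tsum fun a => spontMass_le P _ a

lemma lastOcc_self (w : List A) : lastOcc w w = 0 := by
  refine le_antisymm ?_ zero_le
  exact (iInf₂_le 0 (by simp)).trans (by simp)

lemma nil_mem_returnFree (w : List A) : [] ∈ returnFree w 0 := by
  simp [returnFree, lastOcc_self]

lemma alpha_le_one [Nonempty A] (w : List A) (k : ℕ) : alpha P w k ≤ 1 := by
  refine (iInf_le _ 0).trans ((iInf₂_le _ (nil_mem_returnFree w)).trans ?_)
  refine (iInf₂_le (List.replicate k (Classical.arbitrary A)) (by simp)).trans ?_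
  exact tsum_iInf_le_one P _

lemma alpha_mono (w : List A) : Monotone (alpha P w) := by
  refine monotone_nat_of_le_succ fun k => ?_
  refine le_iInf fun i => le_iInf fun b => le_iInf fun hb => le_iInf fun c => le_iInf fun hc => ?_
  refine (iInf_le _ i).trans ((iInf₂_le b hb).trans ((iInf₂_le (c.take k) (by simp [hc])).trans ?_))
  refine ENNReal.tsum_le_tsum fun a => ?_
  have := iInf_append_le P (b ++ w ++ c.take k) (c.drop k) a
  rwa [List.append_assoc _ (c.take k), List.take_append_drop] at this

lemma alphaNegOne_le_alphaPred (w : List A) (k : ℕ) : alphaNegOne P ≤ alphaPred P w k := by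
  cases k with
  | zero => exact le_rfl
  | succ k => exact alphaNegOne_le_alpha P w k

lemma alphaNegOne_le_one [Nonempty A] : alphaNegOne P ≤ 1 := by
  exact (alphaNegOne_le_alpha P [] 0).trans (alpha_le_one P [] 0)

lemma alphaNegOne_pos (hE : (minorized P).Nonempty) : 0 < alphaNegOne P := by
  obtain ⟨a, ha⟩ := hE
  exact lt_of_lt_of_le ha (ENNReal.le_tsum a)

lemma ctxMass_mono (w v : List A) (a : A) : Monotone fun k => ctxMass P w v k a := by
  refine monotone_nat_of_le_succ fun k => ?_
  have := iInf_append_le P (v.take ((lastOcc w v).toNat + w.length + k))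
    ((v.drop ((lastOcc w v).toNat + w.length + k)).take 1) a
  rwa [← List.take_add] at this

lemma ctxMassPred_le (w v : List A) (k : ℕ) (a : A) :
    ctxMassPred P w v k a ≤ ctxMass P w v k a := by
  cases k with
  | zero => exact spontMass_le P _ a
  | succ k => exact ctxMass_mono P w v a k.le_succ

lemma tsum_ctxMassPred_add (w v : List A) (k : ℕ) :
    ∑' b, ctxMassPred P w v k b + ∑' b, (ctxMass P w v k b - ctxMassPred P w v k b) =
      ∑' b, ctxMass P w v k b := by
  rw [← ENNReal.tsum_add]
  exact tsum_congr fun b => add_tsub_cancel_of_le (ctxMassPred_le P w v k b)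

lemma tsum_ctxMass_mono (w v : List A) : Monotone fun k => ∑' b, ctxMass P w v k b :=
  fun _ _ h => ENNReal.tsum_le_tsum fun b => ctxMass_mono P w v b h

end Infima

/-! ### Last occurrence of the reference string and contexts -/

section Occurrences

variable {A : Type*}

lemma lastOcc_le {w v : List A} {k : ℕ} (h : w <+: v.drop k) : lastOcc w v ≤ k :=
  iInf₂_le k h

lemma exists_prefix_of_lastOcc {w v : List A} {m : ℕ} (h : lastOcc w v = m) :
    w <+: v.drop m := by
  by_contra hcon
  have : ((m + 1 : ℕ) : ℕ∞) ≤ lastOcc w v := by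
    refine le_iInf₂ fun k hk => ?_
    have h1 := lastOcc_le hk
    rw [h] at h1
    have h2 : m ≤ k := by exact_mod_cast h1
    have h3 : m ≠ k := fun e => hcon (e ▸ hk)
    exact_mod_cast (by omega : m + 1 ≤ k)
  rw [h] at this
  have : m + 1 ≤ m := by exact_mod_cast this
  omega

lemma HasContext.exists_lastOcc {w v : List A} {l : ℕ} (h : HasContext w l v) :
    ∃ m : ℕ, lastOcc w v = m ∧ m + w.length + l ≤ v.length := by
  unfold HasContext at h
  obtain ⟨m, hm⟩ : ∃ m : ℕ, lastOcc w v = m := by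
    cases hv : lastOcc w v with
    | top => simp [hv] at h
    | coe m => exact ⟨m, rfl⟩
  refine ⟨m, hm, ?_⟩
  rw [hm] at h
  exact_mod_cast h

lemma HasContext.mono {w v : List A} {k l : ℕ} (hkl : k ≤ l) (h : HasContext w l v) :
    HasContext w k v := by
  unfold HasContext at h ⊢
  exact le_trans (by gcongr) h

lemma hasContext_of_occurrence {w v : List A} {m l : ℕ} (h : w <+: v.drop m)
    (hl : m + w.length + l ≤ v.length) : HasContext w l v := by
  unfold HasContext
  calc lastOcc w v + w.length + l ≤ (m : ℕ∞) + w.length + l := by gcongr; exact lastOcc_le h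
    _ ≤ v.length := by exact_mod_cast hl

/-- An occurrence at distance `k` involves only the `k + |w|` most recent symbols; this locality
makes contexts insensitive to older symbols. -/
lemma prefix_drop_append {w v v' : List A} {k : ℕ} (hk : k + w.length ≤ v.length) :
    w <+: (v ++ v').drop k ↔ w <+: v.drop k := by
  rw [List.drop_append_of_le_length (by omega)]
  constructor
  · intro h
    exact List.prefix_of_prefix_length_le h (List.prefix_append _ _) (by simp; omega)
  · intro h
    exact h.trans (List.prefix_append _ _)

lemma HasContext.lastOcc_append {w v : List A} {l : ℕ} (h : HasContext w l v) (v' : List A) :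
    lastOcc w (v ++ v') = lastOcc w v := by
  obtain ⟨m, hm, hlen⟩ := h.exists_lastOcc
  rw [hm]
  refine le_antisymm (lastOcc_le ((prefix_drop_append (by omega)).2 (exists_prefix_of_lastOcc hm))) ?_
  refine le_iInf₂ fun k hk => ?_
  by_contra! hlt
  have hkm : k < m := by exact_mod_cast hlt
  have := lastOcc_le ((prefix_drop_append (by omega)).1 hk)
  rw [hm] at this
  exact absurd this (not_le.2 hlt)

lemma HasContext.append {w v : List A} {l : ℕ} (h : HasContext w l v) (v' : List A) :
    HasContext w l (v ++ v') := by
  have := h.lastOcc_append v'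
  unfold HasContext at h ⊢
  rw [this]
  exact h.trans (by exact_mod_cast (by simp : v.length ≤ (v ++ v').length))

variable (P : Stream' A → PMF A)

/-- The past splits as `b ++ w ++ r` at the last occurrence of `w`. Here `b` is return-free, since a
more recent occurrence in `b ++ w` would also be one in `v`; so `b` and the first `l` symbols of `r`
are admissible in the infimum. -/
lemma HasContext.alpha_le {w v : List A} {l : ℕ} (h : HasContext w l v) :
    alpha P w l ≤ ∑' a, ctxMass P w v l a := by
  obtain ⟨m, hm, hlen⟩ := h.exists_lastOcc
  obtain ⟨r, hr⟩ := exists_prefix_of_lastOcc hm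
  have hv : v = v.take m ++ w ++ r := by
    rw [List.append_assoc, hr, List.take_append_drop]
  have htl : (v.take m).length = m := by simp; omega
  have hrl : l ≤ r.length := by
    have := congrArg List.length hv
    simp only [List.length_append, htl] at this
    omega
  have hb : v.take m ∈ returnFree w m := by
    refine ⟨htl, le_antisymm (lastOcc_le ?_) (le_iInf₂ fun k hk => ?_)⟩
    · rw [List.drop_append_of_le_length htl.ge, List.drop_of_length_le htl.le]
      simp
    · by_contra! hlt
      have hkm : k < m := by exact_mod_cast hlt
      have h2 : w <+: v.drop k := by
        rw [hv]
        exact (prefix_drop_append (by simp; omega)).2 hk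
      have := lastOcc_le h2
      rw [hm] at this
      exact absurd this (not_le.2 hlt)
  refine (iInf_le _ m).trans ((iInf₂_le _ hb).trans
    ((iInf₂_le (r.take l) (by simp [hrl])).trans ?_))
  refine ENNReal.tsum_le_tsum fun a => le_of_eq ?_
  unfold ctxMass
  rw [hm, ENat.toNat_natCast]
  have : v.take (m + w.length + l) = v.take m ++ w ++ r.take l := by
    conv_lhs => rw [hv]
    rw [List.take_append, List.take_of_length_le (by simp; omega)]
    congr 2
    simp
    omega
  rw [this]

lemma HasContext.ctxMass_append {w v : List A} {l : ℕ} (h : HasContext w l v) (v' : List A)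
    {k : ℕ} (hk : k ≤ l) : ctxMass P w (v ++ v') k = ctxMass P w v k := by
  obtain ⟨m, hm, hlen⟩ := h.exists_lastOcc
  funext a
  unfold ctxMass
  rw [h.lastOcc_append, hm, ENat.toNat_natCast, List.take_append_of_le_length (by omega)]

lemma HasContext.ctxMassPred_append {w v : List A} {l : ℕ} (h : HasContext w l v) (v' : List A)
    {k : ℕ} (hk : k ≤ l) : ctxMassPred P w (v ++ v') k = ctxMassPred P w v k := by
  cases k with
  | zero => rfl
  | succ k => exact h.ctxMass_append P v' (by omega)

lemma HasContext.ctxInterval_append [Encodable A] {w v : List A} {l : ℕ} (h : HasContext w l v)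
    (v' : List A) {k : ℕ} (hk : k ≤ l) :
    ctxInterval P w (v ++ v') k = ctxInterval P w v k := by
  funext a
  unfold ctxInterval
  rw [h.ctxMass_append P v' hk, h.ctxMassPred_append P v' hk]

end Occurrences

/-! ### The update function: uniqueness, stability, existence -/

section Update

variable {A : Type*} [Encodable A] (P : Stream' A → PMF A) (w : List A)

lemma mem_ctxInterval {v : List A} {k : ℕ} {a : A} {u : ℝ≥0∞} (h : u ∈ ctxInterval P w v k a) :
    ∑' b, ctxMassPred P w v k b ≤ u ∧ u < ∑' b, ctxMass P w v k b := by
  have := glued_subset h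
  rwa [tsum_ctxMassPred_add] at this

lemma mem_spontInterval {a : A} {u : ℝ≥0∞} (h : u ∈ spontInterval P a) : u < alphaNegOne P := by
  have := (glued_subset h).2
  rwa [zero_add] at this

/-- Level `k` fills `[∑ ctxMassPred k, ∑ ctxMass k)`, and each level starts where the previous one
ends, so two levels never overlap. -/
lemma ctxInterval_unique {v : List A} {k l : ℕ} {a b : A} {u : ℝ≥0∞}
    (ha : u ∈ ctxInterval P w v k a) (hb : u ∈ ctxInterval P w v l b) : a = b := by
  have key : ∀ {k l : ℕ} {a b : A}, u ∈ ctxInterval P w v k a → u ∈ ctxInterval P w v l b →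
      k ≤ l := by
    intro k l a b ha hb
    by_contra! hlt
    obtain ⟨j, rfl⟩ : ∃ j, k = j + 1 := ⟨k - 1, by omega⟩
    have h1 := (mem_ctxInterval P w ha).1
    have h2 := (mem_ctxInterval P w hb).2
    have h3 : ∑' b, ctxMass P w v l b ≤ ∑' b, ctxMass P w v j b :=
      tsum_ctxMass_mono P w v (by omega)
    exact absurd (h1.trans_lt (h2.trans_le h3)) (lt_irrefl _)
  obtain rfl := le_antisymm (key ha hb) (key hb ha)
  exact glued_unique ha hb

lemma Selects.unique {u : ℝ≥0∞} {v : List A} {a b : A} (ha : Selects P w u v a)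
    (hb : Selects P w u v b) : a = b := by
  rcases ha with ⟨h1, h2⟩ | ⟨l, hl, -, -, k, -, hk⟩ <;>
  rcases hb with ⟨h1', h2'⟩ | ⟨l', hl', -, -, k', -, hk'⟩
  · exact glued_unique h2 h2'
  · exact absurd (h1.trans_le ((alphaNegOne_le_alphaPred P w l').trans hl')) (lt_irrefl _)
  · exact absurd (h1'.trans_le ((alphaNegOne_le_alphaPred P w l).trans hl)) (lt_irrefl _)
  · exact ctxInterval_unique P w hk hk'

lemma update_eq_some {u : ℝ} {v : List A} {a : A} :
    update P w u v = some a ↔ Selects P w (ENNReal.ofReal u) v a := by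
  unfold update
  split_ifs with h
  · rw [Option.some.injEq]
    exact ⟨fun e => e ▸ h.choose_spec, fun ha => h.choose_spec.unique P w ha⟩
  · simp only [false_iff]
    exact fun ha => h ⟨a, ha⟩

/-- The context lies inside `v`, so adding older symbols changes neither the last occurrence nor the
intervals up to level `l`. The correctness of the algorithm rests on this stability. -/
lemma update_append {u : ℝ} {v : List A} {a : A} (h : update P w u v = some a) (v' : List A) :
    update P w u (v ++ v') = some a := by
  rw [update_eq_some] at h ⊢
  rcases h with h | ⟨l, h1, h2, hc, k, hk, hu⟩
  · exact Or.inl h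
  · refine Or.inr ⟨l, h1, h2, hc.append v', k, hk, ?_⟩
    rwa [hc.ctxInterval_append P v' hk]

lemma update_of_mem_spontInterval {u : ℝ} {a : A} (h : ENNReal.ofReal u ∈ spontInterval P a)
    (v : List A) : update P w u v = some a :=
  (update_eq_some P w).2 (Or.inl ⟨mem_spontInterval P h, h⟩)

lemma exists_update_of_lt_alphaNegOne {u : ℝ} (h : ENNReal.ofReal u < alphaNegOne P)
    (v : List A) : ∃ a, update P w u v = some a := by
  obtain ⟨a, ha⟩ := exists_mem_glued (A := A) (s := 0) (len := spontMass P) zero_le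
    (by rwa [zero_add])
  exact ⟨a, update_of_mem_spontInterval P w ha v⟩

lemma exists_update_of_hasContext {u : ℝ} {v : List A} {l : ℕ} (hc : HasContext w l v)
    (h : ENNReal.ofReal u < alpha P w l) : ∃ a, update P w u v = some a := by
  classical
  by_cases h0 : ENNReal.ofReal u < alphaNegOne P
  · exact exists_update_of_lt_alphaNegOne P w h0 v
  have hex : ∃ j, ENNReal.ofReal u < alpha P w j := ⟨l, h⟩
  have hjl : Nat.find hex ≤ l := Nat.find_min' hex h
  have hpred : alphaPred P w (Nat.find hex) ≤ ENNReal.ofReal u := by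
    rcases hj : Nat.find hex with _ | j
    · exact not_lt.1 h0
    · exact not_lt.1 (Nat.find_min hex (by omega : j < Nat.find hex))
  -- Two levels are in play: the uniform level `Nat.find hex` comes from `alpha`, while the interval
  -- containing `u` is found from the masses of the actual past. The bound `HasContext.alpha_le`
  -- makes the second at most the first, as `Selects` requires.
  have hex2 : ∃ k, ENNReal.ofReal u < ∑' b, ctxMass P w v k b :=
    ⟨_, (Nat.find_spec hex).trans_le ((hc.mono hjl).alpha_le P)⟩
  have hkj : Nat.find hex2 ≤ Nat.find hex :=
    Nat.find_min' hex2 ((Nat.find_spec hex).trans_le ((hc.mono hjl).alpha_le P))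
  have hpred2 : ∑' b, ctxMassPred P w v (Nat.find hex2) b ≤ ENNReal.ofReal u := by
    rcases hk : Nat.find hex2 with _ | k
    · exact not_lt.1 h0
    · exact not_lt.1 (Nat.find_min hex2 (by omega : k < Nat.find hex2))
  obtain ⟨a, ha⟩ := exists_mem_glued (len := fun b => ctxMass P w v (Nat.find hex2) b -
    ctxMassPred P w v (Nat.find hex2) b) hpred2 (by
      rw [tsum_ctxMassPred_add]; exact Nat.find_spec hex2)
  exact ⟨a, (update_eq_some P w).2
    (Or.inr ⟨_, hpred, Nat.find_spec hex, hc.mono hjl, _, hkj, ha⟩)⟩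

/-- Only the spontaneous symbols can be selected without looking at the past. -/
lemma lt_alphaNegOne_of_update_nil {u : ℝ} {a : A} (h : update P w u [] = some a) :
    ENNReal.ofReal u < alphaNegOne P := by
  rw [update_eq_some] at h
  rcases h with h | ⟨l, h1, h2, hc, -⟩
  · exact h.1
  · obtain ⟨m, -, hlen⟩ := hc.exists_lastOcc
    -- An empty past has a context only if `w` is empty and `l = 0`, and then the level-zero masses
    -- are those of `α₋₁`.
    simp only [List.length_nil, nonpos_iff_eq_zero, Nat.add_eq_zero_iff] at hlen
    obtain ⟨⟨rfl, hw⟩, rfl⟩ := hlen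
    rw [List.length_eq_zero_iff] at hw
    subst hw
    refine h2.trans_le ((hc.alpha_le P).trans (le_of_eq ?_))
    exact tsum_congr fun a => by simp [ctxMass, spontMass]

end Update

/-! ### Strings read from a trajectory and from the memory -/

section Windows

variable {A : Type*}

lemma window_eq (a : ℤ → A) (m i : ℤ) :
    window a m i = (List.range (i - m).toNat).map fun j : ℕ => a (i - 1 - (j : ℤ)) := by
  simp only [window, bind, pure, ← List.map_eq_flatMap, List.map_map, Function.comp_def]

lemma memWindow_eq (X : ℤ → Option A) (m i : ℤ) :
    memWindow X m i = (List.range (i - m).toNat).filterMap fun j : ℕ => X (i - 1 - (j : ℤ)) := by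
  simp only [memWindow, bind, pure, ← List.map_eq_flatMap, List.filterMap_map, Function.comp_def]

lemma length_window (a : ℤ → A) (m i : ℤ) : (window a m i).length = (i - m).toNat := by
  simp [window]

lemma window_self (a : ℤ → A) (m : ℤ) : window a m m = [] := by simp [window]

lemma window_succ (a : ℤ → A) {s i : ℤ} (h : s ≤ i) :
    window a s (i + 1) = a i :: window a s i := by
  rw [window_eq, window_eq, show (i + 1 - s).toNat = (i - s).toNat + 1 by omega,
    List.range_succ_eq_map, List.map_cons, List.map_map]
  congr 1
  · congr 1; push_cast; omega
  · refine List.map_congr_left fun j _ => ?_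
    simp only [Function.comp]
    congr 1
    push_cast
    omega

lemma memWindow_self (X : ℤ → Option A) (m : ℤ) : memWindow X m m = [] := by simp [memWindow]

lemma memWindow_congr {X Y : ℤ → Option A} {m i : ℤ} (h : ∀ l, m ≤ l → l < i → X l = Y l) :
    memWindow X m i = memWindow Y m i := by
  rw [memWindow_eq, memWindow_eq]
  refine List.filterMap_congr fun j hj => h _ ?_ ?_ <;> rw [List.mem_range] at hj <;> omega

lemma memWindow_some (a : ℤ → A) (m i : ℤ) :
    memWindow (fun l => some (a l)) m i = window a m i := by
  rw [memWindow_eq, window_eq]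
  rw [← List.filterMap_eq_map]; rfl

lemma memWindow_eq_window {X : ℤ → Option A} {a : ℤ → A} {m i : ℤ}
    (h : ∀ l, m ≤ l → l < i → X l = some (a l)) : memWindow X m i = window a m i := by
  rw [memWindow_congr h, memWindow_some]

lemma memWindow_append (X : ℤ → Option A) {m r i : ℤ} (h1 : m ≤ r) (h2 : r ≤ i) :
    memWindow X r i ++ memWindow X m r = memWindow X m i := by
  rw [memWindow_eq, memWindow_eq, memWindow_eq]
  have : (i - m).toNat = (i - r).toNat + (r - m).toNat := by omega
  rw [this, List.range_add, List.filterMap_append, List.filterMap_map]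
  congr 1
  refine List.filterMap_congr fun j _ => ?_
  simp only [Function.comp]
  congr 1
  push_cast
  omega

end Windows

/-! ### Deterministic correctness of the algorithm -/

section Algorithm

variable {A : Type*} [Encodable A] (P : Stream' A → PMF A) (w : List A) (u : ℤ → ℝ)

/-- The first site of a window sees the empty past. This justifies the skip loop. -/
lemma Constructible.lt_alphaNegOne {m n : ℤ} (h : Constructible P w u m n) (hmn : m ≤ n) :
    ENNReal.ofReal (u m) < alphaNegOne P := by
  obtain ⟨a, ha⟩ := h
  have := ha m le_rfl (by exact_mod_cast hmn)
  rw [window_self] at this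
  exact lt_alphaNegOne_of_update_nil P w this

/-- Every site of `[i, n]` outside of `B` has been constructed from constructed sites of
`[i, n]`. -/
structure Justified (X : ℤ → Option A) (B : Finset ℤ) (i n : ℤ) : Prop where
  subset : B ⊆ Finset.Icc i n
  just : ∀ j, i ≤ j → j ≤ n → j ∉ B → ∃ r, i ≤ r ∧ r ≤ j ∧ (∀ l, r ≤ l → l ≤ j → l ∉ B) ∧
    (X j).isSome ∧ update P w (u j) (memWindow X r j) = X j

namespace Justified

variable {P w u} {X : ℤ → Option A} {B : Finset ℤ} {i n : ℤ}

lemma update_eq (h : Justified P w u X B i n) {j : ℤ} (hij : i ≤ j) (hjn : j ≤ n) (hB : j ∉ B) :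
    (X j).isSome ∧ update P w (u j) (memWindow X i j) = X j := by
  obtain ⟨r, hir, hrj, -, hs, hu⟩ := h.just j hij hjn hB
  refine ⟨hs, ?_⟩
  obtain ⟨a, ha⟩ := Option.isSome_iff_exists.1 hs
  rw [ha] at hu ⊢
  rw [← memWindow_append X hir hrj]
  exact update_append P w hu _

lemma constructible (h : Justified P w u X B i n) (hin : i ≤ n) (hB : B = ∅) :
    Constructible P w u i n := by
  subst hB
  have hX : ∀ j, i ≤ j → j ≤ n → (X j).isSome := fun j h1 h2 => (h.update_eq h1 h2 (by simp)).1
  obtain ⟨e, -⟩ := Option.isSome_iff_exists.1 (hX i le_rfl hin)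
  have hX' : ∀ j, i ≤ j → j ≤ n → X j = some ((X j).getD e) := by
    intro j h1 h2
    obtain ⟨a, ha⟩ := Option.isSome_iff_exists.1 (hX j h1 h2)
    simp [ha]
  refine ⟨fun j => (X j).getD e, fun j h1 h2 => ?_⟩
  have h2 : j ≤ n := by exact_mod_cast h2
  rw [← memWindow_eq_window (X := X) fun l hl1 hl2 => hX' l hl1 (by omega), ← hX' j h1 h2]
  exact (h.update_eq h1 h2 (by simp)).2

/-- By induction from `i`, any witness must coincide with the memory on `[i, t)`; it would then have
to supply a symbol at `t`, where the update is `⋆`. -/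
lemma not_constructible (h : Justified P w u X B i n) {t : ℤ} (hit : i ≤ t) (htn : t ≤ n)
    (hB : ∀ l, i ≤ l → l < t → l ∉ B) (ht : ¬ (update P w (u t) (memWindow X i t)).isSome) :
    ¬ Constructible P w u i n := by
  rintro ⟨a, ha⟩
  have key : ∀ k : ℕ, ∀ j, i ≤ j → j < t → j < i + k → X j = some (a j) := by
    intro k
    induction k with
    | zero => intro j h1 h2 h3; omega
    | succ k ih =>
      intro j h1 h2 h3
      rw [← (h.update_eq h1 (by omega) (hB j h1 h2)).2,
        memWindow_eq_window fun l hl1 hl2 => ih l hl1 (by omega) (by omega)]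
      exact ha j h1 (by exact_mod_cast (by omega : j ≤ n))
  refine ht ?_
  rw [memWindow_eq_window fun l hl1 hl2 => key (l - i + 1).toNat l hl1 hl2 (by omega),
    ha t hit (by exact_mod_cast htn)]
  rfl

lemma insert_pred (h : Justified P w u X B i n) (hin : i ≤ n) :
    Justified P w u X (insert (i - 1) B) (i - 1) n := by
  refine ⟨fun l hl => ?_, fun j h1 h2 hj => ?_⟩
  · rw [Finset.mem_insert] at hl
    rw [Finset.mem_Icc]
    rcases hl with rfl | hl
    · omega
    · have := Finset.mem_Icc.1 (h.subset hl)
      omega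
  · rw [Finset.mem_insert, not_or] at hj
    obtain ⟨r, hir, hrj, hr, hs⟩ := h.just j (by omega) h2 hj.2
    refine ⟨r, by omega, hrj, fun l hl1 hl2 => ?_, hs⟩
    rw [Finset.mem_insert, not_or]
    exact ⟨by omega, hr l hl1 hl2⟩

lemma assign (h : Justified P w u X B i n) {t : ℤ} (ht : t ∈ B)
    (hB : ∀ l, i ≤ l → l < t → l ∉ B)
    (hs : (update P w (u t) (memWindow X i t)).isSome) :
    Justified P w u (Function.update X t (update P w (u t) (memWindow X i t))) (B.erase t) i n := by
  have htI := Finset.mem_Icc.1 (h.subset ht)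
  refine ⟨(Finset.erase_subset _ _).trans h.subset, fun j h1 h2 hj => ?_⟩
  rw [Finset.mem_erase, not_and_or, not_not] at hj
  by_cases hjt : j = t
  · subst hjt
    refine ⟨i, le_rfl, h1, fun l hl1 hl2 hl => ?_, ?_, ?_⟩
    · rw [Finset.mem_erase] at hl
      exact hB l hl1 (by omega) hl.2
    · rwa [Function.update_self]
    · rw [Function.update_self]
      congr 1
      exact memWindow_congr fun l hl1 hl2 => Function.update_of_ne (by omega) _ _
  · obtain ⟨r, hir, hrj, hr, hs', hu⟩ := h.just j h1 h2 (hj.resolve_left hjt)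
    refine ⟨r, hir, hrj, fun l hl1 hl2 hl => hr l hl1 hl2 (Finset.mem_of_mem_erase hl), ?_, ?_⟩
    · rwa [Function.update_of_ne hjt]
    · rw [Function.update_of_ne hjt, ← hu]
      congr 1
      -- The window that justifies `j` avoids `B`, whereas `t ∈ B`, so writing at `t` does not touch
      -- it.
      refine memWindow_congr fun l hl1 hl2 => Function.update_of_ne ?_ _ _
      rintro rfl
      exact hr l hl1 hl2.le ht

end Justified

/-- Started from the configuration `s`, the algorithm stops and returns `r`. -/
def HaltsWith (m : ℤ) (s : Config A) (r : ℤ) : Prop :=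
  ∃ N : ℕ, ((step P w u m)^[N] s).pc = .halt ∧ ((step P w u m)^[N] s).theta = r

variable {P w u}

lemma HaltsWith.of_step {m r : ℤ} {s s' : Config A} (hs : step P w u m s = s')
    (h : HaltsWith P w u m s' r) : HaltsWith P w u m s r := by
  obtain ⟨N, hN⟩ := h
  refine ⟨N + 1, ?_⟩
  rwa [Function.iterate_succ_apply, hs]

section Run

variable {m n r : ℤ}

lemma haltsWith_outerTest_empty {i t θ : ℤ} {X : ℤ → Option A} :
    HaltsWith P w u m ⟨.outerTest, i, t, θ, ∅, X⟩ i := by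
  refine .of_step (s' := ⟨.setTime, i, t, θ, ∅, X⟩) (by simp [step]) ?_
  exact .of_step (s' := ⟨.halt, i, t, i, ∅, X⟩) rfl ⟨0, rfl, rfl⟩

/-- The invariant is `r ≤ i`. If `B` is empty then `[i, n]` is constructible and maximality forces
`i = r`; otherwise `i ≠ r`, and moving back keeps `r ≤ i - 1`. -/
lemma haltsWith_outerTest (hmn : m ≤ n)
    (hmax : ∀ k, k ≤ m → Constructible P w u k n → k ≤ r) {i : ℤ} (hri : r ≤ i) (him : i ≤ m)
    (hC : Constructible P w u r n)
    (ih : ∀ t θ B X, Justified P w u X B (i - 1) n → r ≤ i - 1 → i - 1 ∈ B →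
      HaltsWith P w u m ⟨.skipTest, i - 1, t, θ, B, X⟩ r)
    {t θ : ℤ} {B : Finset ℤ} {X : ℤ → Option A} (hJ : Justified P w u X B i n)
    (hB : B.Nonempty → ¬ Constructible P w u i n) :
    HaltsWith P w u m ⟨.outerTest, i, t, θ, B, X⟩ r := by
  rcases B.eq_empty_or_nonempty with rfl | hne
  · obtain rfl : i = r := le_antisymm (hmax i him (hJ.constructible (him.trans hmn) rfl)) hri
    exact haltsWith_outerTest_empty
  · have hri' : r ≠ i := by
      rintro rfl
      exact hB hne hC
    refine .of_step (s' := ⟨.backMove, i, t, θ, B, X⟩) (by simp [step, hne]) ?_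
    refine .of_step (s' := ⟨.backAdd, i - 1, t, θ, B, X⟩) rfl ?_
    refine .of_step (s' := ⟨.skipTest, i - 1, t, θ, insert (i - 1) B, X⟩) rfl ?_
    exact ih _ _ _ _ (hJ.insert_pred (him.trans hmn)) (by omega) (by simp)

lemma untopD_min_spec {B : Finset ℤ} {t : ℤ} (h : B.Nonempty) :
    B.min.untopD t ∈ B ∧ ∀ l ∈ B, B.min.untopD t ≤ l := by
  obtain ⟨b, hb⟩ := Finset.min_of_nonempty h
  rw [hb]
  exact ⟨Finset.mem_of_min hb, fun l hl => Finset.min_le_of_eq hl hb⟩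

/-- Each pass removes `t = min B`, so the induction is on the cardinality of `B`. The loop is left
either with `B` empty or with a blocked site that refutes constructibility from `i`. -/
lemma haltsWith_extTest {i : ℤ}
    (houter : ∀ t θ B X, Justified P w u X B i n → (B.Nonempty → ¬ Constructible P w u i n) →
      HaltsWith P w u m ⟨.outerTest, i, t, θ, B, X⟩ r) (c : ℕ) :
    ∀ (t θ : ℤ) (B : Finset ℤ) (X : ℤ → Option A), B.card = c → Justified P w u X B i n →
      (B.Nonempty → t ∈ B ∧ ∀ l ∈ B, t ≤ l) →
      HaltsWith P w u m ⟨.extTest, i, t, θ, B, X⟩ r := by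
  induction c with
  | zero =>
    intro t θ B X hc hJ _
    rw [Finset.card_eq_zero] at hc
    subst hc
    refine .of_step (s' := ⟨.outerTest, i, t, θ, ∅, X⟩) (by simp [step]) (houter _ _ _ _ hJ ?_)
    exact fun h => absurd rfl h.ne_empty
  | succ c ih =>
    intro t θ B X hc hJ ht
    have hne : B.Nonempty := Finset.card_pos.1 (by omega)
    obtain ⟨htB, hmin⟩ := ht hne
    have hlt : ∀ l, i ≤ l → l < t → l ∉ B := fun l _ h2 hl => absurd (hmin l hl) (by omega)
    have htI := Finset.mem_Icc.1 (hJ.subset htB)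
    by_cases hs : (update P w (u t) (memWindow X i t)).isSome
    · refine .of_step (s' := ⟨.extAssign, i, t, θ, B, X⟩) (by simp only [step]; exact if_pos ⟨hne, hs⟩) ?_
      refine .of_step (s' := ⟨.extRemove, i, t, θ, B, _⟩) rfl ?_
      refine .of_step (s' := ⟨.extMin, i, t, θ, B.erase t, _⟩) rfl ?_
      refine .of_step (s' := ⟨.extTest, i, _, θ, B.erase t, _⟩) rfl ?_
      refine ih _ _ _ _ ?_ (hJ.assign htB hlt hs) fun h => untopD_min_spec h
      rw [Finset.card_erase_of_mem htB, hc]; rfl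
    · refine .of_step (s' := ⟨.outerTest, i, t, θ, B, X⟩)
        (by simp only [step]; exact if_neg fun h => hs h.2) ?_
      exact houter _ _ _ _ hJ fun _ => hJ.not_constructible htI.1 htI.2 hlt hs

lemma haltsWith_skipTest (hmn : m ≤ n) (hC : Constructible P w u r n)
    (hmax : ∀ k, k ≤ m → Constructible P w u k n → k ≤ r) (d : ℕ) :
    ∀ i, i = r + d → i ≤ m → ∀ (t θ : ℤ) (B : Finset ℤ) (X : ℤ → Option A),
      Justified P w u X B i n → i ∈ B → HaltsWith P w u m ⟨.skipTest, i, t, θ, B, X⟩ r := by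
  induction d with
  | zero | succ d ih =>
    intro i hi him t θ B X hJ hiB
    have ih' : ∀ t θ B X, Justified P w u X B (i - 1) n → r ≤ i - 1 → i - 1 ∈ B →
        HaltsWith P w u m ⟨.skipTest, i - 1, t, θ, B, X⟩ r := by
      intro t θ B X hJ hr hB
      first
      | exact absurd hr (by push_cast at hi; omega)
      | exact ih (i - 1) (by push_cast at hi; omega) (by omega) t θ B X hJ hB
    by_cases hu : alphaNegOne P ≤ ENNReal.ofReal (u i)
    · have hri : r ≠ i := by
        rintro rfl
        exact absurd (hC.lt_alphaNegOne P w u (by omega)) (not_lt.2 hu)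
      refine .of_step (s' := ⟨.skipMove, i, t, θ, B, X⟩) (by simp [step, hu]) ?_
      refine .of_step (s' := ⟨.skipAdd, i - 1, t, θ, B, X⟩) rfl ?_
      refine .of_step (s' := ⟨.skipTest, i - 1, t, θ, insert (i - 1) B, X⟩) rfl ?_
      exact ih' _ _ _ _ (hJ.insert_pred (him.trans hmn)) (by omega) (by simp)
    · have hB := fun l (hl : l ∈ B) => (Finset.mem_Icc.1 (hJ.subset hl)).1
      have hs : (update P w (u i) (memWindow X i i)).isSome :=
        Option.isSome_iff_exists.2 (exists_update_of_lt_alphaNegOne P w (not_le.1 hu) _)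
      have hJ' := hJ.assign hiB (fun l h1 h2 => absurd h2 (not_lt.2 h1)) hs
      rw [memWindow_self] at hJ'
      refine .of_step (s' := ⟨.seedAssign, i, t, θ, B, X⟩) (by simp [step, hu]) ?_
      refine .of_step (s' := ⟨.seedRemove, i, t, θ, B, _⟩) rfl ?_
      refine .of_step (s' := ⟨.seedMin, i, t, θ, B.erase i, _⟩) rfl ?_
      refine .of_step (s' := ⟨.extTest, i, _, θ, B.erase i, _⟩) rfl ?_
      refine haltsWith_extTest (n := n) ?_ _ _ _ _ _ rfl hJ' fun h => untopD_min_spec h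
      intro t θ B X hJ hB
      exact haltsWith_outerTest hmn hmax (by omega) him hC ih' hJ hB

lemma haltsWith_fwdTest
    (houter : ∀ t θ B X, Justified P w u X B m n → (B.Nonempty → ¬ Constructible P w u m n) →
      HaltsWith P w u m ⟨.outerTest, m, t, θ, B, X⟩ r) (c : ℕ) :
    ∀ (i t θ : ℤ) (X : ℤ → Option A), m ≤ i → n + 1 - i ≤ c →
      Justified P w u X (Finset.Icc i n) m n →
      HaltsWith P w u m ⟨.fwdTest, i, t, θ, Finset.Icc i n, X⟩ r := by
  -- Whenever the forward loop stops with work left, the site `i` is blocked given all of `[m, i)`,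
  -- so `[m, n]` is not constructible.
  have leave : ∀ (i t θ : ℤ) (X : ℤ → Option A), m ≤ i → Justified P w u X (Finset.Icc i n) m n →
      ¬ ((Finset.Icc i n).Nonempty ∧ (update P w (u i) (memWindow X m i)).isSome) →
      HaltsWith P w u m ⟨.fwdTest, i, t, θ, Finset.Icc i n, X⟩ r := by
    intro i t θ X hmi hJ h
    refine .of_step (s' := ⟨.restart, i, t, θ, Finset.Icc i n, X⟩)
      (by simp only [step]; exact if_neg h) ?_
    refine .of_step (s' := ⟨.outerTest, m, t, θ, Finset.Icc i n, X⟩) rfl ?_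
    refine houter _ _ _ _ hJ fun hne => ?_
    refine hJ.not_constructible hmi (Finset.nonempty_Icc.1 hne) (fun l _ hl hl' => ?_)
      fun hs => h ⟨hne, hs⟩
    exact absurd (Finset.mem_Icc.1 hl').1 (not_le.2 hl)
  induction c with
  | zero =>
    intro i t θ X hmi hc hJ
    refine leave i t θ X hmi hJ fun h => ?_
    have := Finset.nonempty_Icc.1 h.1
    push_cast at hc
    omega
  | succ c ih =>
    intro i t θ X hmi hc hJ
    by_cases h : (Finset.Icc i n).Nonempty ∧ (update P w (u i) (memWindow X m i)).isSome
    · have hin := Finset.nonempty_Icc.1 h.1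
      have hJ' := hJ.assign (t := i) (by simpa using hin)
        (fun l _ hl hl' => absurd (Finset.mem_Icc.1 hl').1 (not_le.2 hl)) h.2
      have herase : (Finset.Icc i n).erase i = Finset.Icc (i + 1) n := by
        ext l
        simp only [Finset.mem_erase, Finset.mem_Icc]
        omega
      refine .of_step (s' := ⟨.fwdAssign, i, t, θ, Finset.Icc i n, X⟩)
        (by simp only [step]; exact if_pos h) ?_
      refine .of_step (s' := ⟨.fwdRemove, i, t, θ, Finset.Icc i n, _⟩) rfl ?_
      refine .of_step (s' := ⟨.fwdNext, i, t, θ, (Finset.Icc i n).erase i, _⟩) rfl ?_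
      refine .of_step (s' := ⟨.fwdTest, i + 1, t, θ, (Finset.Icc i n).erase i, _⟩) rfl ?_
      rw [herase] at hJ' ⊢
      exact ih _ _ _ _ (by omega) (by push_cast at hc; omega) hJ'
    · exact leave i t θ X hmi hJ h

/-- The algorithm returns the last time `r ≤ m` such that `[r, n]` is constructible. -/
theorem stopsWith_of_isGreatest (hmn : m ≤ n)
    (h : IsGreatest {k : ℤ | k ≤ m ∧ Constructible P w u k n} r) : StopsWith P w u m n r := by
  obtain ⟨⟨hrm, hC⟩, hub⟩ := h
  have hmax : ∀ k, k ≤ m → Constructible P w u k n → k ≤ r := fun k h1 h2 => hub ⟨h1, h2⟩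
  refine haltsWith_fwdTest (n := n) (r := r) ?_ (n + 1 - m).toNat m m m (fun _ => none) le_rfl
    (by omega) ⟨subset_rfl, fun j h1 h2 h3 => absurd (Finset.mem_Icc.2 ⟨h1, h2⟩) h3⟩
  intro t θ B X hJ hB
  refine haltsWith_outerTest hmn hmax hrm le_rfl hC ?_ hJ hB
  intro t θ B X hJ hr hi
  exact haltsWith_skipTest hmn hC hmax (m - 1 - r).toNat (m - 1) (by omega) (by omega) _ _ _ _ hJ hi

end Run

section RegenTime

variable {m : ℤ} {n : WithTop ℤ}

lemma exists_regenTime_eq (h : ∃ k ≤ m, Constructible P w u k n) :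
    ∃ r : ℤ, regenTime P w u m n = r ∧
      IsGreatest {k : ℤ | k ≤ m ∧ Constructible P w u k n} r := by
  have hne : {k : ℤ | k ≤ m ∧ Constructible P w u k n}.Nonempty := h
  have hbdd : BddAbove {k : ℤ | k ≤ m ∧ Constructible P w u k n} := ⟨m, fun k hk => hk.1⟩
  exact ⟨_, if_pos hne, Int.csSup_mem hne hbdd, fun k hk => le_csSup hbdd hk⟩

lemma le_regenTime {k : ℤ} (hk : k ≤ m) (h : Constructible P w u k n) :
    (k : WithBot ℤ) ≤ regenTime P w u m n := by
  obtain ⟨r, hr, hg⟩ := exists_regenTime_eq ⟨k, hk, h⟩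
  rw [hr]
  exact_mod_cast hg.2 ⟨hk, h⟩

end RegenTime

end Algorithm

/-! ### A sufficient condition for constructibility in terms of the uniforms -/

section Surrogate

variable {A : Type*} [Encodable A] (P : Stream' A → PMF A) (w : List A) (u : ℤ → ℝ)

/-- The variables `u_j, …, u_{j+|w|-1}` spontaneously select the string `w`. -/
def WordAt (j : ℤ) : Prop :=
  ∀ (r : ℕ) (h : r < w.length), ENNReal.ofReal (u (j + w.length - 1 - r)) ∈ spontInterval P w[r]

/-- A condition on `u_s, …, u_i` which ensures that the site `i` can be constructed once
the sites of `[s, i-1]` are. -/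
def SiteOk (s i : ℤ) : Prop :=
  ENNReal.ofReal (u i) < alphaNegOne P ∨
    ∃ j, s ≤ j ∧ j + w.length ≤ i ∧ WordAt P w u j ∧
      ENNReal.ofReal (u i) < alpha P w (j - s).toNat

/-- No site of `[m, n]` satisfies `SiteOk` all the way up to `n`. -/
def NoStart (m n : ℤ) : Prop :=
  ∀ s, m ≤ s → s ≤ n → ∃ i, s ≤ i ∧ i ≤ n ∧ ¬ SiteOk P w u s i

/-- The site `s` satisfies `SiteOk` up to infinity. -/
def AllOk (s : ℤ) : Prop :=
  ∀ i, s ≤ i → SiteOk P w u s i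

variable {P w u}

/-- Starting earlier leaves more symbols before the copy of `w`, and `alpha` increases with that
number. -/
lemma SiteOk.mono {s s' i : ℤ} (h : SiteOk P w u s i) (hs : s' ≤ s) : SiteOk P w u s' i := by
  rcases h with h | ⟨j, h1, h2, h3, h4⟩
  · exact Or.inl h
  · exact Or.inr ⟨j, hs.trans h1, h2, h3, h4.trans_le (alpha_mono P w (by omega))⟩

lemma NoStart.disjoint_allOk {m n n' : ℤ} (hm : m ≤ n + 1) (hn : n < n')
    (h : NoStart P w u m n') (h' : AllOk P w u (n + 1)) : False := by
  obtain ⟨i, h1, -, h2⟩ := h (n + 1) hm (by omega)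
  exact h2 (h' i h1)

lemma prefix_drop_window {a : ℤ → A} {s i j : ℤ} (hsj : s ≤ j) (hji : j + w.length ≤ i)
    (ha : ∀ l, s ≤ l → l < i → update P w (u l) (window a s l) = some (a l))
    (hw : WordAt P w u j) : w <+: (window a s i).drop (i - j - w.length).toNat := by
  rw [List.prefix_iff_getElem]
  refine ⟨?_, fun r hr => ?_⟩
  · rw [List.length_drop, length_window]
    omega
  · have h1 := ha (j + w.length - 1 - r) (by omega) (by omega)
    rw [update_of_mem_spontInterval P w (hw r hr), Option.some.injEq] at h1
    simp only [List.getElem_drop, window_eq, List.getElem_map, List.getElem_range]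
    rw [h1]
    congr 1
    push_cast
    omega

/-- The trajectory is built recursively from `s`, `V k` being its first `k` symbols. The default `e`
is never used within the window, because the hypothesis supplies a symbol at each site. -/
lemma constructible_of_forall [Nonempty A] {s : ℤ} {n : WithTop ℤ}
    (h : ∀ (a : ℤ → A) (i : ℤ), s ≤ i → (i : WithTop ℤ) ≤ n →
      (∀ l, s ≤ l → l < i → update P w (u l) (window a s l) = some (a l)) →
      ∃ x, update P w (u i) (window a s i) = some x) : Constructible P w u s n := by
  let e : A := Classical.arbitrary A
  let V : ℕ → List A := fun k =>
    Nat.rec [] (fun k v => (update P w (u (s + k)) v).getD e :: v) k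
  let a : ℤ → A := fun i => (update P w (u i) (V (i - s).toNat)).getD e
  have hV : ∀ k : ℕ, window a s (s + k) = V k := by
    intro k
    induction k with
    | zero => simp [window_self, V]
    | succ k ih =>
      rw [Nat.cast_succ, ← add_assoc, window_succ a (by omega), ih]
      simp [V, a]
  have ha : ∀ i, s ≤ i → a i = (update P w (u i) (window a s i)).getD e := by
    intro i hi
    have := hV (i - s).toNat
    rw [show s + ((i - s).toNat : ℤ) = i by omega] at this
    rw [this]
  have key : ∀ k : ℕ, ∀ i, s ≤ i → i < s + k → (i : WithTop ℤ) ≤ n →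
      update P w (u i) (window a s i) = some (a i) := by
    intro k
    induction k with
    | zero => intro i h1 h2; omega
    | succ k ih =>
      intro i h1 h2 h3
      obtain ⟨x, hx⟩ := h a i h1 h3 fun l hl1 hl2 => ih l hl1 (by omega)
        (le_trans (by exact_mod_cast hl2.le) h3)
      rw [ha i h1, hx]
      rfl
  exact ⟨a, fun i h1 h2 => key (i - s + 1).toNat i h1 (by omega) h2⟩

lemma constructible_of_siteOk [Nonempty A] {s : ℤ} {n : WithTop ℤ}
    (h : ∀ i : ℤ, s ≤ i → (i : WithTop ℤ) ≤ n → SiteOk P w u s i) : Constructible P w u s n := by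
  refine constructible_of_forall fun a i hsi hin ha => ?_
  rcases h i hsi hin with h | ⟨j, h1, h2, h3, h4⟩
  · exact exists_update_of_lt_alphaNegOne P w h _
  · refine exists_update_of_hasContext P w
      (hasContext_of_occurrence (prefix_drop_window h1 h2 ha h3) ?_) h4
    -- The occurrence is at distance `i - j - |w|`; with `w` and the `j - s` older symbols it
    -- exactly fills the window of length `i - s`.
    rw [length_window]
    omega

lemma le_regenTime_of_not_noStart [Nonempty A] {m n : ℤ} (h : ¬ NoStart P w u m n) :
    (m : WithBot ℤ) ≤ regenTime P w u n n := by
  unfold NoStart at h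
  push Not at h
  obtain ⟨s, h1, h2, h3⟩ := h
  refine le_trans (by exact_mod_cast h1) (le_regenTime (k := s) h2 (constructible_of_siteOk ?_))
  intro i hi hin
  exact h3 i hi (by exact_mod_cast hin)

/-- For each `n` a start that is valid up to `n` can be pushed back to `s ≤ m`. Only finitely many
starts lie in `[k, m]`, so one of them is valid for all `n`. -/
lemma exists_allOk {m k : ℤ} (h : ∀ n, m ≤ n → ¬ NoStart P w u k n) :
    ∃ s, s ≤ m ∧ AllOk P w u s := by
  have h' : ∀ n, m ≤ n → ∃ s, k ≤ s ∧ s ≤ n ∧ ∀ i, s ≤ i → i ≤ n → SiteOk P w u s i := by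
    intro n hn
    have := h n hn
    unfold NoStart at this
    push Not at this
    exact this
  have h2 : ∀ n, m ≤ n → ∃ s, k ≤ s ∧ s ≤ m ∧ ∀ i, s ≤ i → i ≤ n → SiteOk P w u s i := by
    intro n hn
    have key : ∀ d : ℕ, ∀ s, k ≤ s → s ≤ n → s ≤ m + d →
        (∀ i, s ≤ i → i ≤ n → SiteOk P w u s i) →
        ∃ s, k ≤ s ∧ s ≤ m ∧ ∀ i, s ≤ i → i ≤ n → SiteOk P w u s i := by
      intro d
      induction d with
      | zero => intro s h1 h2 h3 h4; exact ⟨s, h1, by omega, h4⟩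
      | succ d ih =>
        intro s h1 h2 h3 h4
        by_cases hs : s ≤ m
        · exact ⟨s, h1, hs, h4⟩
        · obtain ⟨s', h1', h2', h4'⟩ := h' (s - 1) (by omega)
          refine ih s' h1' (by omega) (by push_cast at h3; omega) fun i hi hin => ?_
          by_cases his : i < s
          · exact h4' i hi (by omega)
          · exact (h4 i (by omega) hin).mono (by omega)
    obtain ⟨s, h1, h2, h3⟩ := h' n hn
    exact key (s - m).toNat s h1 h2 (by omega) h3
  by_contra! hcon
  have h3 : ∀ s ∈ Finset.Icc k m, ∃ i, s ≤ i ∧ ¬ SiteOk P w u s i := by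
    intro s hs
    have := hcon s (Finset.mem_Icc.1 hs).2
    unfold AllOk at this
    push Not at this
    exact this
  choose! f hf using h3
  obtain ⟨n, hn⟩ := (Finset.image f (Finset.Icc k m) ∪ {m}).exists_le
  obtain ⟨s, h1, h4, h5⟩ := h2 n (hn m (by simp))
  have hs : s ∈ Finset.Icc k m := Finset.mem_Icc.2 ⟨h1, h4⟩
  exact (hf s hs).2 (h5 _ (hf s hs).1
    (hn _ (Finset.mem_union_left _ (Finset.mem_image_of_mem f hs))))

end Surrogate

/-! ### Infinite products and sums of defects -/

section Products

/-- For numbers in `(0, 1]` bounded away from zero, the product is positive if and only if the sum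
of the defects is finite. -/
lemma tsum_one_sub_lt_top_iff {a : ℕ → ℝ≥0∞} (h1 : ∀ k, a k ≤ 1) (h0 : ∀ k, 0 < a k) :
    ∑' k, (1 - a k) < ∞ ↔ 0 < ⨅ N : ℕ, ∏ k ∈ Finset.range N, a k := by
  -- For independent trials with success probabilities `b k`, this splits the total mass by the
  -- index of the first failure.
  have tele : ∀ (b : ℕ → ℝ≥0∞), (∀ k, b k ≤ 1) → ∀ N : ℕ,
      ∑ k ∈ Finset.range N, (∏ j ∈ Finset.range k, b j) * (1 - b k) +
        ∏ k ∈ Finset.range N, b k = 1 := by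
    intro b hb N
    induction N with
    | zero => simp
    | succ N ih =>
      rw [Finset.sum_range_succ, Finset.prod_range_succ, add_assoc, ← mul_add,
        tsub_add_cancel_of_le (hb N), mul_one, ih]
  have prod_le : ∀ (b : ℕ → ℝ≥0∞), (∀ k, b k ≤ 1) → ∀ N, ∏ k ∈ Finset.range N, b k ≤ 1 :=
    fun b hb N => Finset.prod_le_one' fun k _ => hb k
  constructor
  · intro hsum
    have htail := ENNReal.tendsto_sum_nat_add (fun k => 1 - a k) hsum.ne
    obtain ⟨K, hK⟩ := (htail.eventually (gt_mem_nhds (zero_lt_one))).exists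
    set ε := ∑' k, (1 - a (k + K)) with hε
    have hpos : 0 < (∏ k ∈ Finset.range K, a k) * (1 - ε) :=
      ENNReal.mul_pos (Finset.prod_ne_zero_iff.2 fun k _ => (h0 k).ne') (tsub_pos_of_lt hK).ne'
    refine hpos.trans_le (le_iInf fun N => ?_)
    have hshift : 1 - ε ≤ ∏ k ∈ Finset.range N, a (K + k) := by
      rw [tsub_le_iff_left, ← tele (fun k => a (K + k)) (fun k => h1 _) N]
      gcongr
      rw [hε]
      refine le_trans (Finset.sum_le_sum fun k _ => ?_)
        (ENNReal.sum_le_tsum (f := fun k => 1 - a (k + K)) (Finset.range N))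
      rw [add_comm k K]
      exact mul_le_of_le_one_left' (prod_le (fun k => a (K + k)) (fun k => h1 _) k)
    calc (∏ k ∈ Finset.range K, a k) * (1 - ε)
        ≤ (∏ k ∈ Finset.range K, a k) * ∏ k ∈ Finset.range N, a (K + k) := by gcongr
      _ = ∏ k ∈ Finset.range (N + K), a k := by
        rw [← Finset.prod_range_add, add_comm]
      _ = (∏ k ∈ Finset.range N, a k) * ∏ k ∈ Finset.range K, a (N + k) :=
        Finset.prod_range_add _ _ _
      _ ≤ ∏ k ∈ Finset.range N, a k :=
        mul_le_of_le_one_right' (prod_le (fun k => a (N + k)) (fun k => h1 _) K)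
  · intro hpos
    set c := ⨅ N : ℕ, ∏ k ∈ Finset.range N, a k
    have hc : c * ∑' k, (1 - a k) ≤ 1 := by
      rw [← ENNReal.tsum_mul_left, ENNReal.tsum_eq_iSup_nat]
      refine iSup_le fun N => ?_
      refine le_trans (Finset.sum_le_sum fun k _ => ?_) (le_self_add.trans (tele a h1 N).le)
      gcongr
      exact iInf_le _ k
    by_contra htop
    rw [not_lt, top_le_iff] at htop
    rw [htop, ENNReal.mul_top hpos.ne'] at hc
    exact absurd hc (by simp)

end Products

/-! ### Measurability of the surrogate events -/

section Measurability

variable {A : Type*} [Encodable A] (P : Stream' A → PMF A) (w : List A)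
  {Ω : Type*} [MeasurableSpace Ω] {U : ℤ → Ω → ℝ}

/-- Only the variables actually read are assumed measurable, here and below, so that the ambient
σ-algebra can be replaced by `sigmaOn U S`. -/
lemma measurableSet_wordAt {j : ℤ} (h : ∀ i, j ≤ i → i < j + w.length → Measurable (U i)) :
    MeasurableSet {ω | WordAt P w (fun i => U i ω) j} := by
  simp only [WordAt, Set.ofPred_forall]
  refine MeasurableSet.iInter fun r => MeasurableSet.iInter fun hr => ?_
  exact (ENNReal.measurable_ofReal.comp (h _ (by omega) (by omega))) measurableSet_Ico

lemma measurableSet_siteOk {s i : ℤ} (hsi : s ≤ i) (h : ∀ l, s ≤ l → l ≤ i → Measurable (U l)) :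
    MeasurableSet {ω | SiteOk P w (fun i => U i ω) s i} := by
  have hU : Measurable fun ω => ENNReal.ofReal (U i ω) :=
    ENNReal.measurable_ofReal.comp (h i hsi le_rfl)
  simp only [SiteOk, Set.ofPred_or, Set.ofPred_exists, Set.ofPred_and]
  refine (measurableSet_lt hU measurable_const).union (MeasurableSet.iUnion fun j => ?_)
  by_cases hj : s ≤ j ∧ j + w.length ≤ i
  · refine (MeasurableSet.const _).inter ((MeasurableSet.const _).inter
      (MeasurableSet.inter ?_ (measurableSet_lt hU measurable_const)))
    exact measurableSet_wordAt P w fun l h1 h2 => h l (by omega) (by omega)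
  · convert MeasurableSet.empty
    ext ω
    simp only [Set.mem_inter_iff, Set.mem_ofPred_eq, Set.mem_empty_iff_false, iff_false]
    tauto

lemma measurableSet_noStart {m n : ℤ} (h : ∀ l, m ≤ l → l ≤ n → Measurable (U l)) :
    MeasurableSet {ω | NoStart P w (fun i => U i ω) m n} := by
  simp only [NoStart, Set.ofPred_forall, Set.ofPred_exists]
  refine MeasurableSet.iInter fun s => MeasurableSet.iInter fun h1 => MeasurableSet.iInter
    fun h2 => MeasurableSet.iUnion fun i => ?_
  by_cases hi : s ≤ i ∧ i ≤ n
  · simp only [hi.1, hi.2, true_and]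
    exact (measurableSet_siteOk P w hi.1 fun l h3 h4 => h l (by omega) (by omega)).compl
  · convert MeasurableSet.empty
    ext ω
    simp only [Set.mem_ofPred_eq, Set.mem_empty_iff_false, iff_false]
    tauto

lemma measurableSet_allOk {s : ℤ} (h : ∀ l, s ≤ l → Measurable (U l)) :
    MeasurableSet {ω | AllOk P w (fun i => U i ω) s} := by
  simp only [AllOk, Set.ofPred_forall]
  exact MeasurableSet.iInter fun i => MeasurableSet.iInter fun h1 =>
    measurableSet_siteOk P w h1 fun l h2 _ => h l h2

end Measurability

/-! ### Translation covariance -/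

section Shift

variable {A : Type*} [Encodable A] (P : Stream' A → PMF A) (w : List A) (u : ℤ → ℝ) (k : ℤ)

lemma wordAt_shift (j : ℤ) : WordAt P w (fun i => u (i + k)) j ↔ WordAt P w u (j + k) := by
  unfold WordAt
  refine forall_congr' fun r => forall_congr' fun h => ?_
  beta_reduce
  rw [show j + w.length - 1 - r + k = j + k + w.length - 1 - r by ring]

lemma siteOk_shift (s i : ℤ) :
    SiteOk P w (fun i => u (i + k)) s i ↔ SiteOk P w u (s + k) (i + k) := by
  unfold SiteOk
  refine or_congr Iff.rfl ((Equiv.addRight k).exists_congr fun j => ?_)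
  rw [wordAt_shift, Equiv.coe_addRight]
  beta_reduce
  rw [show j + k - (s + k) = j - s by ring]
  refine and_congr (by omega) (and_congr (by omega) Iff.rfl)

lemma noStart_shift (m n : ℤ) :
    NoStart P w (fun i => u (i + k)) m n ↔ NoStart P w u (m + k) (n + k) := by
  unfold NoStart
  refine (Equiv.addRight k).forall_congr fun s => ?_
  rw [Equiv.coe_addRight]
  beta_reduce
  refine imp_congr (by omega) (imp_congr (by omega) ((Equiv.addRight k).exists_congr fun i => ?_))
  rw [siteOk_shift, Equiv.coe_addRight]
  beta_reduce
  exact and_congr (by omega) (and_congr (by omega) Iff.rfl)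

lemma allOk_shift (s : ℤ) : AllOk P w (fun i => u (i + k)) s ↔ AllOk P w u (s + k) := by
  unfold AllOk
  refine (Equiv.addRight k).forall_congr fun i => ?_
  rw [siteOk_shift, Equiv.coe_addRight]
  beta_reduce
  exact imp_congr (by omega) Iff.rfl

end Shift

/-! ### σ-algebras generated by sets of sites -/

section SigmaOn

variable {Ω : Type*} {U : ℤ → Ω → ℝ}

/-- The events which depend on the variables of index in `S`. -/
abbrev sigmaOn (U : ℤ → Ω → ℝ) (S : Set ℤ) : MeasurableSpace Ω :=
  ⨆ i ∈ S, MeasurableSpace.comap (U i) inferInstance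

lemma measurable_sigmaOn {S : Set ℤ} {i : ℤ} (hi : i ∈ S) : Measurable[sigmaOn U S] (U i) := by
  rw [measurable_iff_comap_le]
  exact le_iSup₂_of_le (f := fun i (_ : i ∈ S) => MeasurableSpace.comap (U i) inferInstance)
    i hi le_rfl

lemma sigmaOn_mono {S T : Set ℤ} (h : S ⊆ T) : sigmaOn U S ≤ sigmaOn U T :=
  biSup_mono h

end SigmaOn

/-! ### Uniform laws, independence and stationarity -/

section Uniform

variable {Ω : Type*} [MeasurableSpace Ω] {μ : Measure Ω} {U : ℤ → Ω → ℝ}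

lemma measure_uniform_mem {X : Ω → ℝ} (hX : Measurable X)
    (hu : pdf.IsUniform X (Set.Ico 0 1) μ volume) {B : Set ℝ} (hB : MeasurableSet B) :
    μ {ω | X ω ∈ B} = volume (Set.Ico (0 : ℝ) 1 ∩ B) := by
  have h := hu
  unfold pdf.IsUniform at h
  have : μ {ω | X ω ∈ B} = μ.map X B := (Measure.map_apply hX hB).symm
  rw [this, h, cond_apply measurableSet_Ico]
  simp

lemma measure_uniform_mem_Ico {X : Ω → ℝ} (hX : Measurable X)
    (hu : pdf.IsUniform X (Set.Ico 0 1) μ volume) {x y : ℝ≥0∞} (hy : y ≤ 1) :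
    μ {ω | ENNReal.ofReal (X ω) ∈ Set.Ico x y} = y - x := by
  rcases le_total y x with hyx | hxy
  · rw [Set.Ico_eq_empty (not_lt.2 hyx), tsub_eq_zero_of_le hyx]
    simp
  have hy' : y ≠ ∞ := ne_top_of_le_ne_top ENNReal.one_ne_top hy
  have hx' : x ≠ ∞ := ne_top_of_le_ne_top hy' hxy
  have hB : MeasurableSet {v : ℝ | ENNReal.ofReal v ∈ Set.Ico x y} :=
    ENNReal.measurable_ofReal measurableSet_Ico
  have hy1 : y.toReal ≤ 1 := by
    have := ENNReal.toReal_mono ENNReal.one_ne_top hy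
    simpa using this
  have : Set.Ico (0 : ℝ) 1 ∩ {v : ℝ | ENNReal.ofReal v ∈ Set.Ico x y} =
      Set.Ico x.toReal y.toReal := by
    ext v
    simp only [Set.mem_inter_iff, Set.mem_Ico, Set.mem_ofPred_eq]
    constructor
    · rintro ⟨⟨h0, -⟩, h1, h2⟩
      exact ⟨(ENNReal.le_ofReal_iff_toReal_le hx' h0).1 h1,
        (ENNReal.ofReal_lt_iff_lt_toReal h0 hy').1 h2⟩
    · rintro ⟨h1, h2⟩
      have h0 : 0 ≤ v := ENNReal.toReal_nonneg.trans h1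
      exact ⟨⟨h0, h2.trans_le hy1⟩, (ENNReal.le_ofReal_iff_toReal_le hx' h0).2 h1,
        (ENNReal.ofReal_lt_iff_lt_toReal h0 hy').2 h2⟩
  rw [show {ω | ENNReal.ofReal (X ω) ∈ Set.Ico x y} =
    {ω | X ω ∈ {v : ℝ | ENNReal.ofReal v ∈ Set.Ico x y}} from rfl,
    measure_uniform_mem hX hu hB, this, Real.volume_Ico, ENNReal.ofReal_sub _ ENNReal.toReal_nonneg,
    ENNReal.ofReal_toReal hx', ENNReal.ofReal_toReal hy']

lemma measure_le_uniform {X : Ω → ℝ} (hX : Measurable X)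
    (hu : pdf.IsUniform X (Set.Ico 0 1) μ volume) (x : ℝ≥0∞) :
    μ {ω | x ≤ ENNReal.ofReal (X ω)} ≤ 1 - x := by
  rw [← measure_uniform_mem_Ico hX hu (x := x) le_rfl]
  have h1 : ∀ᵐ ω ∂μ, X ω ∈ Set.Ico (0 : ℝ) 1 := by
    have := measure_uniform_mem hX hu (B := (Set.Ico (0 : ℝ) 1)ᶜ) measurableSet_Ico.compl
    rw [Set.inter_compl_self, measure_empty] at this
    exact this
  refine measure_mono_ae ?_
  filter_upwards [h1] with ω hω hx
  exact ⟨hx, ENNReal.ofReal_lt_one.2 hω.2⟩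

lemma sigmaOn_le (hU : ∀ i, Measurable (U i)) (S : Set ℤ) :
    sigmaOn U S ≤ (inferInstance : MeasurableSpace Ω) :=
  iSup₂_le fun i _ => (hU i).comap_le

lemma measure_inter_of_disjoint (hU : ∀ i, Measurable (U i)) (hI : iIndepFun U μ)
    {S T : Set ℤ} (hST : Disjoint S T) {E F : Set Ω} (hE : MeasurableSet[sigmaOn U S] E)
    (hF : MeasurableSet[sigmaOn U T] F) : μ (E ∩ F) = μ E * μ F := by
  have := indep_iSup_of_disjoint (m := fun i => MeasurableSpace.comap (U i) inferInstance)
    (fun i => (hU i).comap_le) hI hST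
  exact (Indep_iff _ _ μ).1 this E F hE hF

/-- The variables are stationary. -/
lemma measure_shift [IsProbabilityMeasure μ] (hU : ∀ i, Measurable (U i))
    (hu : ∀ i, pdf.IsUniform (U i) (Set.Ico 0 1) μ volume) (hI : iIndepFun U μ) (k : ℤ)
    {B : Set (ℤ → ℝ)} (hB : MeasurableSet B) :
    μ {ω | (fun i => U (i + k) ω) ∈ B} = μ {ω | (fun i => U i ω) ∈ B} := by
  have hI' : iIndepFun (fun i => U (i + k)) μ := hI.precomp (add_left_injective k)
  have e1 := (iIndepFun_iff_map_fun_eq_infinitePi_map hU).1 hI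
  have e2 := (iIndepFun_iff_map_fun_eq_infinitePi_map fun i => hU (i + k)).1 hI'
  have h : μ.map (fun ω i => U (i + k) ω) = μ.map (fun ω i => U i ω) := by
    rw [e1, e2]
    congr 1
    funext i
    exact (hu (i + k)).trans (hu i).symm
  rw [show {ω | (fun i => U (i + k) ω) ∈ B} = (fun ω i => U (i + k) ω) ⁻¹' B from rfl,
    ← Measure.map_apply (measurable_pi_iff.2 fun i => hU (i + k)) hB, h,
    Measure.map_apply (measurable_pi_iff.2 hU) hB]
  rfl

/-- Independent events of the same probability, carried by consecutive blocks of sites. -/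
lemma measure_biInter_blocks [IsProbabilityMeasure μ] (hU : ∀ i, Measurable (U i))
    (hI : iIndepFun U μ) {Q : ℕ} {H : ℕ → Set Ω} {x : ℝ≥0∞}
    (hH : ∀ j : ℕ, MeasurableSet[sigmaOn U (Set.Ico (j * Q : ℤ) (j * Q + Q))] (H j))
    (hx : ∀ j, μ (H j) = x) (a d : ℕ) : μ (⋂ j ∈ Finset.Ico a (a + d), H j) = x ^ d := by
  induction d with
  | zero => simp
  | succ d ih =>
    rw [← add_assoc, ← Finset.insert_Ico_right_eq_Ico_add_one (by omega : a ≤ a + d),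
      Finset.set_biInter_insert, Set.inter_comm,
      measure_inter_of_disjoint (S := Set.Iio ((a + d : ℕ) * Q : ℤ))
        (T := Set.Ici ((a + d : ℕ) * Q : ℤ)) hU hI ?_ ?_ ?_, ih, hx, pow_succ]
    · exact Set.disjoint_left.2 fun i h1 h2 => absurd (Set.mem_Iio.1 h1) (not_lt.2 (Set.mem_Ici.1 h2))
    · refine Finset.measurableSet_biInter _ fun j hj => ?_
      refine sigmaOn_mono ?_ _ (hH j)
      intro i hi
      refine hi.2.trans_le ?_
      have : j + 1 ≤ a + d := (Finset.mem_Ico.1 hj).2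
      have : ((j + 1 : ℕ) : ℤ) * Q ≤ ((a + d : ℕ) : ℤ) * Q := by gcongr
      push_cast at this ⊢
      linarith
    · exact sigmaOn_mono (fun i hi => hi.1) _ (hH _)

end Uniform

/-! ### Two auxiliary series -/

section Series

lemma tsum_div_eq (f : ℕ → ℝ≥0∞) (R : ℕ) [NeZero R] :
    ∑' k, f (k / R) = R * ∑' k, f k := by
  have := (Nat.divModEquiv R).tsum_eq fun x : ℕ × Fin R => f x.1
  rw [show ∑' k, f (k / R) = ∑' k, f ((Nat.divModEquiv R k).1) from rfl, this, ENNReal.tsum_prod']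
  simp [ENNReal.tsum_mul_left]

lemma tsum_pow_sub_half_lt_top {x : ℝ≥0∞} (hx : x < 1) : ∑' J : ℕ, x ^ (J - J / 2) < ∞ := by
  refine lt_of_le_of_lt (ENNReal.tsum_le_tsum fun J =>
    pow_le_pow_right_of_le_one' hx.le (by omega : J / 2 ≤ J - J / 2)) ?_
  rw [tsum_div_eq (fun k => x ^ k) 2, ENNReal.tsum_geometric]
  refine ENNReal.mul_lt_top (by simp) ?_
  rw [ENNReal.inv_lt_top]
  exact tsub_pos_of_lt hx

end Series

/-! ### Positive probability of a good half-line, and renewal -/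

section Regeneration

variable {A : Type*} [Encodable A] {P : Stream' A → PMF A} {w : List A}

lemma WordAt.lt_alphaNegOne {u : ℤ → ℝ} {j i : ℤ} (h : WordAt P w u j) (h1 : j ≤ i)
    (h2 : i < j + w.length) : ENNReal.ofReal (u i) < alphaNegOne P := by
  have := h (j + w.length - 1 - i).toNat (by omega)
  rw [show j + w.length - 1 - ((j + w.length - 1 - i).toNat : ℤ) = i by omega] at this
  exact mem_spontInterval P this

lemma WordAt.tail {u : ℤ → ℝ} {j : ℤ} {e : A} (h : WordAt P (e :: w) u j) : WordAt P w u j := by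
  intro r hr
  have := h (r + 1) (by simpa using hr)
  rw [List.getElem_cons_succ] at this
  rwa [show j + w.length - 1 - (r : ℤ) = j + (e :: w).length - 1 - ((r + 1 : ℕ) : ℤ) by
    rw [List.length_cons]; push_cast; ring]

section Probability

variable {Ω : Type*} [MeasurableSpace Ω] {μ : Measure Ω} {U : ℤ → Ω → ℝ}

lemma measure_wordAt (hU : ∀ i, Measurable (U i))
    (hu : ∀ i, pdf.IsUniform (U i) (Set.Ico 0 1) μ volume) (hI : iIndepFun U μ) (j : ℤ) :
    μ {ω | WordAt P w (fun i => U i ω) j} = ∏ r : Fin w.length, spontMass P w[r] := by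
  have hinj : Function.Injective fun r : Fin w.length => j + w.length - 1 - (r : ℤ) := by
    intro r s h
    have h' : j + w.length - 1 - (r : ℤ) = j + w.length - 1 - (s : ℤ) := h
    exact Fin.ext (by omega)
  have hI' := hI.precomp hinj
  have hmeas : ∀ r : Fin w.length,
      MeasurableSet {v : ℝ | ENNReal.ofReal v ∈ spontInterval P w[r]} := fun r =>
    ENNReal.measurable_ofReal measurableSet_Ico
  have := hI'.measure_inter_preimage_eq_mul Finset.univ fun r _ => hmeas r
  rw [show {ω | WordAt P w (fun i => U i ω) j} = ⋂ r ∈ (Finset.univ : Finset (Fin w.length)),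
    U (j + w.length - 1 - (r : ℤ)) ⁻¹' {v : ℝ | ENNReal.ofReal v ∈ spontInterval P w[r]} by
      ext ω
      simp only [WordAt, Set.mem_ofPred_eq, Finset.mem_univ, Set.iInter_true, Set.mem_iInter,
        Set.mem_preimage]
      exact ⟨fun h r => h r r.2, fun h r hr => h ⟨r, hr⟩⟩]
  refine this.trans (Finset.prod_congr rfl fun r _ => ?_)
  have : Nonempty A := ⟨w[r]⟩
  refine (measure_uniform_mem_Ico (hU _) (hu _) ?_).trans ?_
  · rw [zero_add]
    refine le_trans ?_ (alphaNegOne_le_one P)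
    have := cumLength_encode_succ (spontMass P) w[r]
    unfold cumLength at this
    rw [← this]
    exact cumLength_le_tsum _ _
  · refine ENNReal.add_sub_cancel_left (ne_top_of_le_ne_top ENNReal.one_ne_top ?_)
    rw [zero_add]
    exact (cumLength_le_tsum (spontMass P) _).trans (alphaNegOne_le_one P)

variable [IsProbabilityMeasure μ]

/-- With positive probability, the whole half-line `[0, ∞)` can be constructed. -/
lemma measure_allOk_pos (hU : ∀ i, Measurable (U i))
    (hu : ∀ i, pdf.IsUniform (U i) (Set.Ico 0 1) μ volume) (hI : iIndepFun U μ)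
    (hE : (minorized P).Nonempty) (hw : ∀ a ∈ w, a ∈ minorized P)
    (hα : ∑' k : ℕ, (1 - alpha P w k) < ∞) :
    0 < μ {ω | AllOk P w (fun i => U i ω) 0} := by
  obtain ⟨e, he⟩ := hE
  have : Nonempty A := ⟨e⟩
  set w' := e :: w with hw'def
  set Q := w'.length with hQdef
  have hQ : Q = w.length + 1 := List.length_cons
  have hQpos : 0 < Q := by omega
  have : NeZero Q := ⟨hQpos.ne'⟩
  let G : ℕ → Set Ω := fun j => {ω | WordAt P w' (fun i => U i ω) ((j : ℤ) * Q)}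
  have hGsig : ∀ j : ℕ, MeasurableSet[sigmaOn U (Set.Ico (j * Q : ℤ) (j * Q + Q))] (G j) :=
    fun j => @measurableSet_wordAt _ _ P w' Ω (sigmaOn U (Set.Ico (j * Q : ℤ) (j * Q + Q))) U _
      fun i h1 h2 => measurable_sigmaOn ⟨h1, h2⟩
  have hGmeas : ∀ j, MeasurableSet (G j) := fun j => sigmaOn_le hU _ _ (hGsig j)
  set p := ∏ r : Fin w'.length, spontMass P w'[r] with hp
  have hμG : ∀ j, μ (G j) = p := fun j => measure_wordAt hU hu hI _
  have hp0 : p ≠ 0 := by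
    refine Finset.prod_ne_zero_iff.2 fun r _ => ?_
    have : w'[r] ∈ minorized P := by
      rcases List.mem_cons.1 (List.getElem_mem r.2 : w'[r] ∈ w') with h | h
      · exact h ▸ he
      · exact hw _ h
    exact (show 0 < spontMass P w'[r] from this).ne'
  have hμGc : ∀ j, μ (G j)ᶜ = 1 - p := fun j => by rw [prob_compl_eq_one_sub (hGmeas j), hμG]
  have hp1 : 1 - p < 1 := ENNReal.sub_lt_self ENNReal.one_ne_top one_ne_zero hp0
  -- the bad events
  let f : ℕ → ℝ≥0∞ := fun k => 1 - alpha P w (k / Q / 2 * Q)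
  let g : ℕ → ℝ≥0∞ := fun J => (1 - p) ^ (J - J / 2)
  have hf : ∑' k, f k < ∞ := by
    -- Each multiple `K * Q` is used as a level by exactly `2 * Q` sites, so the sum is controlled
    -- by the defects at the multiples of `Q`.
    have h1 := tsum_div_eq (fun K => 1 - alpha P w (K * Q)) (Q * 2)
    simp only [← Nat.div_div_eq_div_mul] at h1
    refine lt_of_eq_of_lt h1 (ENNReal.mul_lt_top (ENNReal.natCast_lt_top _) ?_)
    refine lt_of_le_of_lt ?_ hα
    exact ENNReal.tsum_comp_le_tsum_of_injective
      (f := fun K => K * Q) (fun a b h => Nat.eq_of_mul_eq_mul_right hQpos h)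
      (fun k => 1 - alpha P w k)
  have hg : ∑' J, g J < ∞ := tsum_pow_sub_half_lt_top hp1
  let badLevel : ℕ → Set Ω := fun k =>
    {ω | alpha P w (k / Q / 2 * Q) ≤ ENNReal.ofReal (U k ω)}
  let badGap : ℕ → Set Ω := fun J => ⋂ j ∈ Finset.Ico (J / 2) (J / 2 + (J - J / 2)), (G j)ᶜ
  have hμL : ∀ k, μ (badLevel k) ≤ f k := fun k => measure_le_uniform (hU _) (hu _) _
  have hμB : ∀ J, μ (badGap J) = g J := fun J =>
    measure_biInter_blocks hU hI (fun j => (hGsig j).compl) hμGc _ _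
  -- Sites from `M * Q` on lie beyond the forced blocks, and for `J ≥ 2 * M` the gap event reads
  -- only blocks of index at least `M`; both are thus independent of the forcing.
  obtain ⟨M, hM, hM1⟩ : ∃ M : ℕ, ∑' t, f (t + M * Q) + ∑' t, g (t + 2 * M) < 1 ∧ 1 ≤ M := by
    have h1 : Filter.Tendsto (fun M : ℕ => M * Q) Filter.atTop Filter.atTop :=
      Filter.tendsto_id.atTop_mul_const' hQpos
    have h2 : Filter.Tendsto (fun M : ℕ => 2 * M) Filter.atTop Filter.atTop :=
      Filter.tendsto_id.const_mul_atTop' two_pos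
    have h3 := ((ENNReal.tendsto_sum_nat_add f hf.ne).comp h1).add
      ((ENNReal.tendsto_sum_nat_add g hg.ne).comp h2)
    rw [add_zero] at h3
    exact ((h3.eventually (gt_mem_nhds zero_lt_one)).and (Filter.eventually_ge_atTop 1)).exists
  let bad : Set Ω := (⋃ t : ℕ, badLevel (t + M * Q)) ∪ ⋃ t : ℕ, badGap (t + 2 * M)
  have hbad : μ bad < 1 := by
    refine lt_of_le_of_lt (measure_union_le _ _) (lt_of_le_of_lt ?_ hM)
    refine add_le_add ((measure_iUnion_le _).trans (ENNReal.tsum_le_tsum fun t => hμL _))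
      ((measure_iUnion_le _).trans (ENNReal.tsum_le_tsum fun t => (hμB _).le))
  have hbadsig : MeasurableSet[sigmaOn U (Set.Ici ((M : ℤ) * Q))] bad := by
    refine MeasurableSet.union (MeasurableSet.iUnion fun t => ?_) (MeasurableSet.iUnion fun t => ?_)
    · have : Measurable[sigmaOn U (Set.Ici ((M : ℤ) * Q))] (U ((t + M * Q : ℕ) : ℤ)) :=
        measurable_sigmaOn (by rw [Set.mem_Ici]; push_cast; omega)
      exact (ENNReal.measurable_ofReal.comp this) measurableSet_Ici
    · refine Finset.measurableSet_biInter _ fun j hj => MeasurableSet.compl ?_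
      refine sigmaOn_mono (fun i hi => ?_) _ (hGsig j)
      have h1 : M ≤ j := by have := (Finset.mem_Ico.1 hj).1; omega
      have h2 : (M : ℤ) * Q ≤ j * Q := by gcongr
      exact h2.trans hi.1
  let forced : Set Ω := ⋂ j ∈ Finset.Ico 0 (0 + M), G j
  have hforced : μ forced = p ^ M := measure_biInter_blocks hU hI hGsig hμG _ _
  have hforcedsig : MeasurableSet[sigmaOn U (Set.Iio ((M : ℤ) * Q))] forced := by
    refine Finset.measurableSet_biInter _ fun j hj => ?_
    refine sigmaOn_mono (fun i hi => ?_) _ (hGsig j)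
    refine Set.mem_Iio.2 (hi.2.trans_le ?_)
    have h1 : j + 1 ≤ M := by have := (Finset.mem_Ico.1 hj).2; omega
    have h2 : ((j + 1 : ℕ) : ℤ) * Q ≤ M * Q := by gcongr
    push_cast at h2
    linarith
  have hpos : 0 < μ (forced ∩ badᶜ) := by
    rw [measure_inter_of_disjoint hU hI (Set.disjoint_left.2 fun i h1 h2 =>
      absurd (Set.mem_Iio.1 h1) (not_lt.2 (Set.mem_Ici.1 h2))) hforcedsig hbadsig.compl, hforced,
      prob_compl_eq_one_sub (sigmaOn_le hU _ _ hbadsig)]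
    exact ENNReal.mul_pos (pow_ne_zero _ hp0) (tsub_pos_of_lt hbad).ne'
  refine hpos.trans_le (measure_mono ?_)
  rintro ω ⟨hF, hB⟩
  have hF' : ∀ j < M, WordAt P w' (fun i => U i ω) ((j : ℤ) * Q) := fun j hj =>
    Set.mem_iInter₂.1 hF j (Finset.mem_Ico.2 ⟨by omega, by omega⟩)
  intro i hi
  obtain ⟨k, rfl⟩ := Int.eq_ofNat_of_zero_le hi
  have hJk : k / Q * Q ≤ k := Nat.div_mul_le_self k Q
  have hkJ : k < k / Q * Q + Q := Nat.lt_div_mul_add hQpos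
  set J := k / Q
  by_cases hJ : J < M
  · left
    refine (hF' J hJ).lt_alphaNegOne (i := k) ?_ ?_
    · exact_mod_cast hJk
    · exact_mod_cast hkJ
  · right
    -- A copy of `w` is needed in a block of index in `[J / 2, J)`: the last forced block serves for
    -- `J < 2 * M`, and the absence of a gap provides one afterwards.
    obtain ⟨j, hj1, hj2, hj3⟩ : ∃ j, J / 2 ≤ j ∧ j < J ∧
        WordAt P w' (fun i => U i ω) ((j : ℤ) * Q) := by
      by_cases hJ2 : J < 2 * M
      · exact ⟨M - 1, by omega, by omega, hF' _ (by omega)⟩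
      · have hgap : ω ∉ badGap J := fun h => hB (Or.inr (Set.mem_iUnion.2 ⟨J - 2 * M, by
          rwa [Nat.sub_add_cancel (by omega)]⟩))
        simp only [badGap, Set.mem_iInter, not_forall, Set.mem_compl_iff, not_not] at hgap
        obtain ⟨j, hj, hG⟩ := hgap
        have := Finset.mem_Ico.1 hj
        exact ⟨j, this.1, by omega, hG⟩
    have hMk : M * Q ≤ k := (Nat.mul_le_mul_right _ (by omega)).trans hJk
    have hlev : ω ∉ badLevel k := fun h => hB (Or.inl (Set.mem_iUnion.2 ⟨k - M * Q, by
      rwa [Nat.sub_add_cancel hMk]⟩))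
    have hlev' : ENNReal.ofReal (U k ω) < alpha P w (J / 2 * Q) := not_le.1 hlev
    refine ⟨(j : ℤ) * Q, by positivity, ?_, hj3.tail, hlev'.trans_le (alpha_mono P w ?_)⟩
    · have h1 : (j + 1) * Q ≤ J * Q := Nat.mul_le_mul_right _ hj2
      have h2 : j * Q + w.length ≤ k := by nlinarith
      exact_mod_cast h2
    · have h1 : J / 2 * Q ≤ j * Q := Nat.mul_le_mul_right _ hj1
      rw [sub_zero, show ((j : ℤ) * Q).toNat = j * Q by exact_mod_cast Int.toNat_natCast (j * Q)]
      exact h1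

lemma measure_noStart_shift (hU : ∀ i, Measurable (U i))
    (hu : ∀ i, pdf.IsUniform (U i) (Set.Ico 0 1) μ volume) (hI : iIndepFun U μ) (m n k : ℤ) :
    μ {ω | NoStart P w (fun i => U i ω) (m + k) (n + k)} =
      μ {ω | NoStart P w (fun i => U i ω) m n} := by
  simp only [← noStart_shift]
  exact measure_shift hU hu hI k
    (B := {u : ℤ → ℝ | NoStart P w u m n})
    (measurableSet_noStart P w (U := fun i (u : ℤ → ℝ) => u i) fun l _ _ => measurable_pi_apply l)

lemma measure_allOk_shift (hU : ∀ i, Measurable (U i))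
    (hu : ∀ i, pdf.IsUniform (U i) (Set.Ico 0 1) μ volume) (hI : iIndepFun U μ) (s k : ℤ) :
    μ {ω | AllOk P w (fun i => U i ω) (s + k)} = μ {ω | AllOk P w (fun i => U i ω) s} := by
  simp only [← allOk_shift]
  exact measure_shift hU hu hI k
    (B := {u : ℤ → ℝ | AllOk P w u s})
    (measurableSet_allOk P w (U := fun i (u : ℤ → ℝ) => u i) fun l _ => measurable_pi_apply l)

/-- The events where there is no start in `[0, l]`, and then the half-line `[l + 1, ∞)` can be
constructed, are disjoint, and each of them is the intersection of two independent events. -/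
lemma tsum_measure_noStart_lt_top (hU : ∀ i, Measurable (U i))
    (hu : ∀ i, pdf.IsUniform (U i) (Set.Ico 0 1) μ volume) (hI : iIndepFun U μ)
    (hE : (minorized P).Nonempty) (hw : ∀ a ∈ w, a ∈ minorized P)
    (hα : ∑' k : ℕ, (1 - alpha P w k) < ∞) :
    ∑' l : ℕ, μ {ω | NoStart P w (fun i => U i ω) 0 l} < ∞ := by
  have hc := measure_allOk_pos hU hu hI hE hw hα
  set c := μ {ω | AllOk P w (fun i => U i ω) 0}
  let E : ℕ → Set Ω := fun l => {ω | NoStart P w (fun i => U i ω) 0 l} ∩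
    {ω | AllOk P w (fun i => U i ω) (l + 1)}
  have hEμ : ∀ l, μ (E l) = μ {ω | NoStart P w (fun i => U i ω) 0 l} * c := by
    intro l
    have h1 := measure_allOk_shift (P := P) (w := w) hU hu hI 0 (l + 1)
    rw [zero_add] at h1
    refine Eq.trans ?_ (congrArg _ h1)
    refine measure_inter_of_disjoint (S := Set.Iio (l + 1 : ℤ)) (T := Set.Ici (l + 1 : ℤ)) hU hI
      (Set.disjoint_left.2 fun i h1 h2 =>
        absurd (Set.mem_Iio.1 h1) (not_lt.2 (Set.mem_Ici.1 h2))) ?_ ?_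
    · exact @measurableSet_noStart _ _ P w Ω (sigmaOn U (Set.Iio (l + 1 : ℤ))) U _ _
        fun i _ h2 => measurable_sigmaOn (Set.mem_Iio.2 (by omega))
    · exact @measurableSet_allOk _ _ P w Ω (sigmaOn U (Set.Ici (l + 1 : ℤ))) U _
        fun i h1 => measurable_sigmaOn h1
  have hdisj : Pairwise (Function.onFun Disjoint E) := by
    have key : ∀ l l' : ℕ, l < l' → Disjoint (E l) (E l') := fun l l' h =>
      Set.disjoint_left.2 fun ω h1 h2 =>
        h2.1.disjoint_allOk (n := l) (by omega) (by exact_mod_cast h) h1.2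
    intro l l' h
    rcases lt_or_gt_of_ne h with h | h
    · exact key l l' h
    · exact (key l' l h).symm
  have hEmeas : ∀ l, MeasurableSet (E l) := fun l =>
    (measurableSet_noStart P w fun i _ _ => hU i).inter (measurableSet_allOk P w fun i _ => hU i)
  have hsum : (∑' l : ℕ, μ {ω | NoStart P w (fun i => U i ω) 0 l}) * c ≤ 1 := by
    rw [← ENNReal.tsum_mul_right]
    simp only [← hEμ]
    rw [← measure_iUnion hdisj hEmeas]
    exact prob_le_one
  by_contra htop
  rw [not_lt, top_le_iff] at htop
  rw [htop, ENNReal.top_mul hc.ne'] at hsum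
  exact absurd hsum (by simp)

/-- Almost surely, some half-line which starts before `m` can be constructed. -/
lemma ae_exists_allOk (hU : ∀ i, Measurable (U i))
    (hu : ∀ i, pdf.IsUniform (U i) (Set.Ico 0 1) μ volume) (hI : iIndepFun U μ)
    (hE : (minorized P).Nonempty) (hw : ∀ a ∈ w, a ∈ minorized P)
    (hα : ∑' k : ℕ, (1 - alpha P w k) < ∞) (m : ℤ) :
    ∀ᵐ ω ∂μ, ∃ s, s ≤ m ∧ AllOk P w (fun i => U i ω) s := by
  have hsum := tsum_measure_noStart_lt_top hU hu hI hE hw hα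
  have htail := ENNReal.tendsto_sum_nat_add _ hsum.ne
  -- If no good half-line starts at or before `m`, then for every `L` some window `[m - L, m + t]`
  -- has no start; the union bound over `t` is the remainder of the series from `L`, which tends to
  -- zero.
  refine le_antisymm (ge_of_tendsto' htail fun L => ?_) zero_le
  refine le_trans (measure_mono (t := ⋃ t : ℕ, {ω | NoStart P w (fun i => U i ω) (m - L) (m + t)})
    fun ω hω => ?_) ((measure_iUnion_le _).trans (ENNReal.tsum_le_tsum fun t => le_of_eq ?_))
  · by_contra hcon
    refine hω (exists_allOk (k := m - L) fun n hn h => hcon (Set.mem_iUnion.2 ⟨(n - m).toNat, ?_⟩))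
    rwa [show m + ((n - m).toNat : ℤ) = n by omega]
  · have := measure_noStart_shift (P := P) (w := w) hU hu hI 0 ((t + L : ℕ) : ℤ) (m - L)
    rw [← this, show (0 : ℤ) + (m - L) = m - L by ring,
      show ((t + L : ℕ) : ℤ) + (m - L) = m + t by push_cast; ring]

end Probability

end Regeneration

end CFTP

theorem theorem2 {A : Type*} [Encodable A] {Ω : Type*} [MeasurableSpace Ω]
    (μ : Measure Ω) [IsProbabilityMeasure μ]
    (U : ℤ → Ω → ℝ) (hU_meas : ∀ i, Measurable (U i))
    (hU_unif : ∀ i, pdf.IsUniform (U i) (Set.Ico 0 1) μ volume)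
    (hU_indep : iIndepFun U μ)
    (P : Stream' A → PMF A) (hE : (CFTP.minorized P).Nonempty)
    (w : List A) (hw : ∀ a ∈ w, a ∈ CFTP.minorized P) :
    -- the two forms of the hypothesis on `α^w_k` are equivalent
    (∑' k : ℕ, (1 - CFTP.alpha P w k) < ∞ ↔
      0 < ⨅ N : ℕ, ∏ k ∈ Finset.range N, CFTP.alpha P w k) ∧
    (∑' k : ℕ, (1 - CFTP.alpha P w k) < ∞ →
      -- finite windows: the algorithm stops, and it returns the regeneration time
      (∀ m n : ℤ, m ≤ n → ∀ᵐ ω ∂μ, ∃ r : ℤ,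
        CFTP.StopsWith P w (fun i => U i ω) m n r ∧
          CFTP.regenTime P w (fun i => U i ω) m n = r) ∧
      -- infinite windows: the regeneration time is finite
      (∀ m : ℤ, ∀ᵐ ω ∂μ, CFTP.regenTime P w (fun i => U i ω) m ⊤ ≠ ⊥) ∧
      -- summability of the tail of the regeneration time
      (∀ n : ℤ, ∑' l : ℕ,
        μ {ω | CFTP.regenTime P w (fun i => U i ω) n n < ((n - l : ℤ) : WithBot ℤ)} < ∞)) := by
  have : Nonempty A := ⟨hE.some⟩
  refine ⟨CFTP.tsum_one_sub_lt_top_iff (CFTP.alpha_le_one P w) fun k =>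
    (CFTP.alphaNegOne_pos P hE).trans_le (CFTP.alphaNegOne_le_alpha P w k), fun hα => ?_⟩
  have hae := CFTP.ae_exists_allOk hU_meas hU_unif hU_indep hE hw hα
  have hC : ∀ (m : ℤ) (n : WithTop ℤ), ∀ᵐ ω ∂μ,
      ∃ k ≤ m, CFTP.Constructible P w (fun i => U i ω) k n := by
    intro m n
    filter_upwards [hae m] with ω ⟨s, hs, h⟩
    exact ⟨s, hs, CFTP.constructible_of_siteOk fun i hi _ => h i hi⟩
  refine ⟨fun m n hmn => ?_, fun m => ?_, fun n => ?_⟩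
  · filter_upwards [hC m n] with ω h
    obtain ⟨r, hr, hg⟩ := CFTP.exists_regenTime_eq h
    exact ⟨r, CFTP.stopsWith_of_isGreatest hmn hg, hr⟩
  · filter_upwards [hC m ⊤] with ω h
    obtain ⟨r, hr, -⟩ := CFTP.exists_regenTime_eq h
    rw [hr]
    exact WithBot.coe_ne_bot
  · refine lt_of_le_of_lt (ENNReal.tsum_le_tsum fun l => ?_)
      (CFTP.tsum_measure_noStart_lt_top hU_meas hU_unif hU_indep hE hw hα)
    -- Translation by `n - l` carries `[0, l]` to `[n - l, n]`, and `θ[n] < n - l` excludes every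
    -- valid start there.
    have := CFTP.measure_noStart_shift (P := P) (w := w) hU_meas hU_unif hU_indep 0 l (n - l)
    rw [zero_add, add_sub_cancel] at this
    rw [← this]
    refine measure_mono fun ω hω => ?_
    by_contra hcon
    exact absurd (CFTP.le_regenTime_of_not_noStart hcon) (not_le.2 hω)
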